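/- Let $(X,\omega)$ be a smooth symplectic manifold of dimension $2n$ (Hausdorff, second countable, without boundary), and let $L,L'\subset X$ be embedded Lagrangian submanifolds that intersect transversely, i.e. $T_xL+T_xL'=T_xX$ for every $x\in L\cap L'$. Assume that $L\cap L'$ is a closed subset of $X$ (this is automatic if $L$ and $L'$ are closed subsets of $X$, e.g. compact). Then there exists a smooth almost complex structure $J$ on $X$ compatible with $\omega$ (that is, $\omega(Ju,Jv)=\omega(u,v)$ for all $u,v$, and $\omega(u,Ju)>0$ for $u\neq 0$) such that the intersection of $L$ and $L'$ is locally standard. Here the intersection of $L$ and $L'$ is called locally standard (with respect to $\omega$ and $J$) if for every $x\in L\cap L'$ there exist an integer $0\le k\le n$, an open set $U\subset\mathbb{C}^n$ containing $0$, and a diffeomorphism $\phi$ from $U$ onto an open subset of $X$ such that $\phi(0)=x$, $\phi^{-1}(L)=U\cap\sqrt{-1}\,\mathbb{R}^n$, $\phi^{-1}(L')=U\cap(\mathbb{R}^{n-k}\times\sqrt{-1}\,\mathbb{R}^k)$, $\phi^*J=J_{\mathbb{C}^n}$ (multiplication by $\sqrt{-1}$) and $\phi^*\omega=\omega_{\mathbb{C}^n}=\sum_{j=1}^n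 dx_j\wedge dy_j$, where $z_j=x_j+\sqrt{-1}\,y_j$. Moreover, for this $J$, the chart at every $x\in L\cap L'$ can be chosen with $k=0$, so that $\phi^{-1}(L)=U\cap\sqrt{-1}\,\mathbb{R}^n$ and $\phi^{-1}(L')=U\cap\mathbb{R}^n$. -/

import Mathlib

open scoped Manifold ContDiff

noncomputable section

/-- The space `ℂⁿ`. -/
abbrev CSpace (n : ℕ) : Type := EuclideanSpace ℂ (Fin n)

/-- The standard symplectic form `∑ⱼ dxⱼ ∧ dyⱼ` of `ℂⁿ`, where `zⱼ = xⱼ + √-1 yⱼ`. -/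
def stdSymplectic {n : ℕ} (u v : CSpace n) : ℝ :=
  ∑ j : Fin n, ((u j).re * (v j).im - (u j).im * (v j).re)

/-- The linear subspace `ℝⁿ⁻ᵏ × √-1 ℝᵏ` of `ℂⁿ`, for `k ≤ n`. -/
def mixedPlane (n k : ℕ) : Set (CSpace n) :=
  {z | ∀ j : Fin n, if (j : ℕ) + k < n then (z j).im = 0 else (z j).re = 0}

/-- The linear subspace `√-1 ℝⁿ` of `ℂⁿ`. -/
def imagPlane (n : ℕ) : Set (CSpace n) :=
  {z | ∀ j : Fin n, (z j).re = 0}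

/-- The linear subspace `ℝⁿ` of `ℂⁿ`. -/
def realPlane (n : ℕ) : Set (CSpace n) :=
  {z | ∀ j : Fin n, (z j).im = 0}

section Structures

variable (E : Type*) [NormedAddCommGroup E] [NormedSpace ℝ E]
  (X : Type*) [TopologicalSpace X] [ChartedSpace E X]

/-- A family of alternating bilinear forms on the tangent spaces of `X`. -/
abbrev TwoForm : Type _ :=
  ∀ x : X, (TangentSpace 𝓘(ℝ, E) x) [⋀^Fin 2]→L[ℝ] ℝ

variable {E X}

/-- The expression of a two-form in the chart `e`, that is, its pullback along `e.symm`
(meaningful on `e.target`). -/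
def TwoForm.inChart (σ : TwoForm E X) (e : OpenPartialHomeomorph X E) (y : E) :
    E [⋀^Fin 2]→L[ℝ] ℝ :=
  (σ (e.symm y)).compContinuousLinearMap (mfderiv 𝓘(ℝ, E) 𝓘(ℝ, E) e.symm y)

variable (E X) in
/-- A symplectic form on `X`: a smooth closed nondegenerate two-form. -/
structure SymplecticForm where
  toForm : TwoForm E X
  smooth : ∀ e ∈ atlas E X, ContDiffOn ℝ ∞ (toForm.inChart e) e.target
  closed : ∀ e ∈ atlas E X, ∀ y ∈ e.target, extDeriv (toForm.inChart e) y = 0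
  nondegenerate : ∀ (x : X) (u : TangentSpace 𝓘(ℝ, E) x),
    (∀ v : TangentSpace 𝓘(ℝ, E) x, toForm x ![u, v] = 0) → u = 0

variable (E X) in
/-- An almost complex structure on `X`: a smooth field of endomorphisms of the tangent spaces of
`X` with square `-1`. -/
structure AlmostComplexStructure [IsManifold 𝓘(ℝ, E) ∞ X] where
  toEnd : ∀ x : X, TangentSpace 𝓘(ℝ, E) x →L[ℝ] TangentSpace 𝓘(ℝ, E) x
  smooth : haveI : IsManifold 𝓘(ℝ, E) 1 X := .of_le (n := ∞) (by simp)
    ContMDiff 𝓘(ℝ, E) (𝓘(ℝ, E).prod 𝓘(ℝ, E →L[ℝ] E)) ∞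
      (fun x ↦ Bundle.TotalSpace.mk' (E →L[ℝ] E)
        (E := fun x : X ↦ TangentSpace 𝓘(ℝ, E) x →L[ℝ] TangentSpace 𝓘(ℝ, E) x) x (toEnd x))
  sq_eq_neg : ∀ (x : X) (u : TangentSpace 𝓘(ℝ, E) x), toEnd x (toEnd x u) = -u

variable [IsManifold 𝓘(ℝ, E) ∞ X]

/-- `J` is compatible with `σ`: `σ(J u, J v) = σ(u, v)`, and `σ(u, J u) > 0` for `u ≠ 0`; in other
words `σ(·, J ·)` is a Riemannian metric. -/
def AlmostComplexStructure.IsCompatible (J : AlmostComplexStructure E X)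
    (σ : SymplecticForm E X) : Prop :=
  ∀ x : X,
    (∀ u v : TangentSpace 𝓘(ℝ, E) x,
      σ.toForm x ![J.toEnd x u, J.toEnd x v] = σ.toForm x ![u, v]) ∧
    (∀ u : TangentSpace 𝓘(ℝ, E) x, u ≠ 0 → 0 < σ.toForm x ![u, J.toEnd x u])

/-- `φ`, defined on the open subset `φ.source` of `ℂⁿ`, is a holomorphic symplectic chart of `X`
centered at `x`: it is a diffeomorphism onto an open subset of `X` with `φ(0) = x`, `φ^* J = J_{ℂⁿ}`
and `φ^* σ = ∑ⱼ dxⱼ ∧ dyⱼ`. -/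
structure IsKahlerChartAt {n : ℕ} (σ : SymplecticForm E X) (J : AlmostComplexStructure E X)
    (x : X) (φ : OpenPartialHomeomorph (CSpace n) X) : Prop where
  zero_mem : 0 ∈ φ.source
  map_zero : φ 0 = x
  smooth : ContMDiffOn 𝓘(ℝ, CSpace n) 𝓘(ℝ, E) ∞ φ φ.source
  smooth_symm : ContMDiffOn 𝓘(ℝ, E) 𝓘(ℝ, CSpace n) ∞ φ.symm φ.target
  pullback_complex : ∀ z ∈ φ.source, ∀ u : CSpace n,
    mfderiv 𝓘(ℝ, CSpace n) 𝓘(ℝ, E) φ z (Complex.I • u : CSpace n) =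
      J.toEnd (φ z) (mfderiv 𝓘(ℝ, CSpace n) 𝓘(ℝ, E) φ z u)
  pullback_symplectic : ∀ z ∈ φ.source, ∀ u v : CSpace n,
    σ.toForm (φ z) ![mfderiv 𝓘(ℝ, CSpace n) 𝓘(ℝ, E) φ z u,
      mfderiv 𝓘(ℝ, CSpace n) 𝓘(ℝ, E) φ z v] = stdSymplectic u v

/-- The intersection of the subsets `A` and `B` of the `2n`-dimensional manifold `X` is locally
standard: around every point of `A ∩ B` there is a holomorphic symplectic chart in which `A` is
`√-1 ℝⁿ` and `B` is `ℝⁿ⁻ᵏ × √-1 ℝᵏ` for some `0 ≤ k ≤ n`. -/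
def LocallyStandard (n : ℕ) (σ : SymplecticForm E X) (J : AlmostComplexStructure E X)
    (A B : Set X) : Prop :=
  ∀ x ∈ A ∩ B, ∃ φ : OpenPartialHomeomorph (CSpace n) X, ∃ k ≤ n,
    IsKahlerChartAt σ J x φ ∧
    φ.source ∩ φ ⁻¹' A = φ.source ∩ imagPlane n ∧
    φ.source ∩ φ ⁻¹' B = φ.source ∩ mixedPlane n k

end Structures

section Lagrangian

variable (n : ℕ) {E : Type*} [NormedAddCommGroup E] [NormedSpace ℝ E]
  {X : Type*} [TopologicalSpace X] [ChartedSpace E X]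
  {L L' : Type*} [TopologicalSpace L] [ChartedSpace (EuclideanSpace ℝ (Fin n)) L]
  [TopologicalSpace L'] [ChartedSpace (EuclideanSpace ℝ (Fin n)) L']

/-- The smooth embedding `ι` of the `n`-dimensional manifold `L` in `X` is Lagrangian:
`dim X = 2n` and `ι^* σ = 0`. Its image is an embedded Lagrangian submanifold of `X`. -/
structure IsLagrangianEmbedding (σ : SymplecticForm E X) (ι : L → X) : Prop where
  isSmoothEmbedding : Manifold.IsSmoothEmbedding (𝓡 n) 𝓘(ℝ, E) ∞ ι
  half_dim : Module.finrank ℝ E = 2 * n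
  isotropic : ∀ (p : L) (u v : TangentSpace (𝓡 n) p),
    σ.toForm (ι p) ![mfderiv (𝓡 n) 𝓘(ℝ, E) ι p u, mfderiv (𝓡 n) 𝓘(ℝ, E) ι p v] = 0

/-- The image of the differential of `ι` at `p`, a subspace of `T_{ι p} X`, whose underlying
vector space is `E`. -/
def tangentImage (E : Type*) [NormedAddCommGroup E] [NormedSpace ℝ E] [ChartedSpace E X]
    (ι : L → X) (p : L) : Submodule ℝ E :=
  (mfderiv (𝓡 n) 𝓘(ℝ, E) ι p : EuclideanSpace ℝ (Fin n) →L[ℝ] E).range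

/-- The images of `ι` and `ι'` intersect transversely: at every intersection point, their tangent
spaces together span the tangent space of `X`. -/
def IntersectTransversely (E : Type*) [NormedAddCommGroup E] [NormedSpace ℝ E]
    [ChartedSpace E X] (ι : L → X) (ι' : L' → X) : Prop :=
  ∀ (p : L) (q : L'), ι p = ι' q →
    tangentImage n E ι p ⊔ tangentImage n E ι' q = ⊤

end Lagrangian

end

/-!
Transversality makes the tangent spaces of `L` and `L'` at a point of `L ∩ L'` complementary, so
near such a point there are coordinates `(a, b)` of `X` with `L = {a = 0}` and `L' = {b = 0}`.
Nondegeneracy then pairs the two coordinate subspaces perfectly, and a linear change of coordinates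
makes the symplectic form standard at the point. Moser's argument makes it standard nearby: since
both symplectic forms vanish on `L` and on `L'`, the radial primitive of their difference vanishes
to second order at the point and restricts to zero on `L` and `L'`, so the flow of the corresponding
vector field preserves `L` and `L'`. As this vector field vanishes to second order, the
linearization of its Picard equation at the zero curve is the identity, and the inverse function
theorem in the space of curves yields a smooth flow. In the resulting Darboux charts `L` is `√-1 ℝⁿ`
and `L'` is `ℝⁿ`; in particular `L ∩ L'` is discrete.

Since `L ∩ L'` is also closed, a partition of unity produces a Riemannian metric on `X` which is
the Euclidean metric of these charts near every point of `L ∩ L'`. The polar part of the symplectic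
form with respect to this metric is a compatible almost complex structure, and by uniqueness of the
polar decomposition it is multiplication by `√-1` in the charts wherever the metric is Euclidean.
The polar part depends smoothly on the metric and the form by the inverse function theorem applied
to squaring of endomorphisms, whose derivative `S ↦ P S + S P` is injective for positive `P`.
-/

noncomputable section

set_option maxSynthPendingDepth 3

open scoped Topology
open Set Filter

/-! ### Superposition operators on spaces of continuous curves -/

section Superposition

universe u

variable {K : Type*} [TopologicalSpace K] [CompactSpace K]

/-- The continuous bilinear map `(A, h) ↦ (t ↦ A t (h t))`, which applies a continuous family of
operators pointwise to a continuous family of vectors. -/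
def pointwiseApplyL (K : Type*) [TopologicalSpace K] [CompactSpace K]
    (E F : Type*) [NormedAddCommGroup E] [NormedSpace ℝ E] [NormedAddCommGroup F]
    [NormedSpace ℝ F] : C(K, E →L[ℝ] F) →L[ℝ] C(K, E) →L[ℝ] C(K, F) :=
  LinearMap.mkContinuous₂
    (LinearMap.mk₂ ℝ (fun (A : C(K, E →L[ℝ] F)) (h : C(K, E)) ↦
        (⟨fun t ↦ A t (h t), by fun_prop⟩ : C(K, F)))
      (fun _ _ _ ↦ by ext; simp) (fun _ _ _ ↦ by ext; simp)
      (fun _ _ _ ↦ by ext; simp) (fun _ _ _ ↦ by ext; simp)) 1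
    (fun A h ↦ by
      rw [one_mul]
      refine (ContinuousMap.norm_le _ (by positivity)).2 fun t ↦ ?_
      exact (A t).le_of_opNorm_le_of_le (A.norm_coe_le_norm t) (h.norm_coe_le_norm t))

@[simp]
theorem pointwiseApplyL_apply {E F : Type*} [NormedAddCommGroup E] [NormedSpace ℝ E]
    [NormedAddCommGroup F] [NormedSpace ℝ F] (A : C(K, E →L[ℝ] F)) (h : C(K, E)) (t : K) :
    pointwiseApplyL K E F A h t = A t (h t) := rfl

theorem exists_norm_taylor_remainder_le_of_isCompact {E F : Type*} [NormedAddCommGroup E]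
    [NormedSpace ℝ E] [NormedAddCommGroup F] [NormedSpace ℝ F] {g : E → F} {g' : E → E →L[ℝ] F}
    (hg : ∀ x, HasFDerivAt g (g' x) x) (hg' : Continuous g') {S : Set E} (hS : IsCompact S)
    {c : ℝ} (hc : 0 < c) :
    ∃ δ > 0, ∀ x ∈ S, ∀ y, dist y x < δ → ‖g y - g x - g' x (y - x)‖ ≤ c * ‖y - x‖ := by
  have hunif := hS.uniformContinuousAt_of_continuousAt g' (fun x _ ↦ hg'.continuousAt)
    (Metric.dist_mem_uniformity hc)
  obtain ⟨δ, hδ, hclose⟩ := Metric.mem_uniformity_dist.1 hunif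
  refine ⟨δ, hδ, fun x hx y hy ↦ ?_⟩
  refine (convex_ball x δ).norm_image_sub_le_of_norm_hasFDerivWithin_le'
    (fun z _ ↦ (hg z).hasFDerivWithinAt) (fun z hz ↦ ?_) (Metric.mem_ball_self hδ) hy
  rw [← dist_eq_norm, dist_comm]
  exact (show dist (g' x) (g' z) < c from hclose (Metric.mem_ball'.1 hz) hx).le

theorem hasFDerivAt_superposition {E F : Type*} [NormedAddCommGroup E] [NormedSpace ℝ E]
    [NormedAddCommGroup F] [NormedSpace ℝ F] (g : C(E, F)) (g' : C(E, E →L[ℝ] F))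
    (hg : ∀ x, HasFDerivAt g (g' x) x) (γ : C(K, E)) :
    HasFDerivAt (fun η : C(K, E) ↦ g.comp η) (pointwiseApplyL K E F (g'.comp γ)) γ := by
  rw [hasFDerivAt_iff_isLittleO, Asymptotics.isLittleO_iff]
  intro c hc
  obtain ⟨δ, hδ, hrem⟩ := exists_norm_taylor_remainder_le_of_isCompact hg g'.continuous
    (isCompact_range γ.continuous) hc
  filter_upwards [Metric.ball_mem_nhds γ hδ] with η hη
  refine (ContinuousMap.norm_le _ (by positivity)).2 fun t ↦ ?_
  calc ‖g (η t) - g (γ t) - g' (γ t) (η t - γ t)‖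
      ≤ c * ‖(η - γ) t‖ :=
        hrem _ (mem_range_self t) _ ((ContinuousMap.dist_apply_le_dist t).trans_lt hη)
    _ ≤ c * ‖η - γ‖ := by
      gcongr
      exact (η - γ).norm_coe_le_norm t

/-- The two spaces live in one universe because the induction on the order of differentiability
replaces `F` by `E →L[ℝ] F`. -/
theorem contDiff_superposition {E F : Type u} [NormedAddCommGroup E] [NormedSpace ℝ E]
    [NormedAddCommGroup F] [NormedSpace ℝ F] (g : C(E, F)) (hg : ContDiff ℝ ∞ g) :
    ContDiff ℝ ∞ (fun η : C(K, E) ↦ g.comp η) := by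
  refine contDiff_infty.2 fun n ↦ ?_
  replace hg := contDiff_infty.1 hg n
  induction n generalizing F with
  | zero => exact contDiff_zero.2 g.continuous_postcomp
  | succ n ih =>
    obtain ⟨g', hg', hgd⟩ := contDiff_succ_iff_hasFDerivAt.1 hg
    refine contDiff_succ_iff_hasFDerivAt.2
      ⟨_, ?_, hasFDerivAt_superposition g ⟨g', hg'.continuous⟩ hgd⟩
    exact (pointwiseApplyL K E F).contDiff.comp (ih ⟨g', hg'.continuous⟩ hg')

end Superposition

theorem exists_openPartialHomeomorph_of_contDiffOn {E F : Type*} [NormedAddCommGroup E]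
    [NormedSpace ℝ E] [CompleteSpace E] [NormedAddCommGroup F] [NormedSpace ℝ F]
    {f : E → F} {U : Set E} (hU : IsOpen U) (hf : ContDiffOn ℝ ∞ f U) {a : E} (ha : a ∈ U)
    (f' : E ≃L[ℝ] F) (hf' : HasFDerivAt f (f' : E →L[ℝ] F) a) :
    ∃ e : OpenPartialHomeomorph E F, ⇑e = f ∧ a ∈ e.source ∧ e.source ⊆ U ∧
      (∀ x ∈ e.source, ∃ D : E ≃L[ℝ] F, HasFDerivAt f (D : E →L[ℝ] F) x) ∧
      ContDiffOn ℝ ∞ e.symm e.target := by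
  have hfU : ∀ x ∈ U, ContDiffAt ℝ ∞ f x := fun x hx ↦ hf.contDiffAt (hU.mem_nhds hx)
  let V := U ∩ fderiv ℝ f ⁻¹' (range ((↑) : (E ≃L[ℝ] F) → (E →L[ℝ] F)))
  have hV : IsOpen V := (hf.continuousOn_fderiv_of_isOpen hU (by simp)).isOpen_inter_preimage hU
    ContinuousLinearEquiv.isOpen
  let e := ((hfU a ha).toOpenPartialHomeomorph f hf' (by simp)).restrOpen V hV
  have hsource : e.source ⊆ V := by
    rw [OpenPartialHomeomorph.restrOpen_source]
    exact inter_subset_right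
  have hderiv : ∀ x ∈ e.source, ∃ D : E ≃L[ℝ] F, HasFDerivAt f (D : E →L[ℝ] F) x := by
    intro x hx
    obtain ⟨hxU, D, hD⟩ := hsource hx
    refine ⟨D, ?_⟩
    rw [hD]
    exact ((hfU x hxU).differentiableAt (by simp)).hasFDerivAt
  refine ⟨e, rfl, ?_, fun x hx ↦ (hsource hx).1, hderiv, fun y hy ↦ ?_⟩
  · rw [OpenPartialHomeomorph.restrOpen_source]
    exact ⟨(hfU a ha).mem_toOpenPartialHomeomorph_source hf' (by simp), ha, f', hf'.fderiv.symm⟩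
  · obtain ⟨D, hD⟩ := hderiv _ (e.map_target hy)
    exact (e.contDiffAt_symm hy hD (hfU _ (hsource (e.map_target hy)).1)).contDiffWithinAt

/-! ### Smooth flows near a degenerate zero -/

section Flow

universe u

open unitInterval

variable {E : Type u} [NormedAddCommGroup E]

/-- The curve `t ↦ (t, γ t)`, which turns a time-dependent vector field into a function of one
variable. -/
def graphCurve (γ : C(I, E)) : C(I, ℝ × E) := ⟨fun t ↦ ((t : ℝ), γ t), by fun_prop⟩

@[simp]
theorem graphCurve_apply (γ : C(I, E)) (t : I) : graphCurve γ t = ((t : ℝ), γ t) := rfl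

variable [NormedSpace ℝ E]

/-- The operator sending a continuous curve on the unit interval to its primitive vanishing at
zero. Curves are extended to `ℝ` by `projIcc`, so that interval integrals apply. -/
def primitiveL (E : Type*) [NormedAddCommGroup E] [NormedSpace ℝ E] : C(I, E) →L[ℝ] C(I, E) :=
  LinearMap.mkContinuous
    { toFun := fun h ↦ ⟨fun t ↦ ∫ s in (0 : ℝ)..t, h (projIcc 0 1 zero_le_one s), by
        have : Continuous fun t : ℝ ↦ ∫ s in (0 : ℝ)..t, h (projIcc 0 1 zero_le_one s) :=
          intervalIntegral.continuous_primitive (fun a b ↦ Continuous.intervalIntegrable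
            (h.continuous.comp continuous_projIcc) a b) 0
        exact this.comp continuous_subtype_val⟩
      map_add' := fun h k ↦ by
        ext t
        exact intervalIntegral.integral_add
          (Continuous.intervalIntegrable (h.continuous.comp continuous_projIcc) _ _)
          (Continuous.intervalIntegrable (k.continuous.comp continuous_projIcc) _ _)
      map_smul' := fun c h ↦ by
        ext t
        exact intervalIntegral.integral_smul c _ } 1
    (fun h ↦ by
      refine (ContinuousMap.norm_le _ (by positivity)).2 fun t ↦ ?_
      have := intervalIntegral.norm_integral_le_of_norm_le_const (a := (0 : ℝ)) (b := t)
        (f := fun s ↦ h (projIcc 0 1 zero_le_one s)) (C := ‖h‖)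
        (fun s _ ↦ h.norm_coe_le_norm _)
      refine this.trans ?_
      rw [mul_comm, sub_zero, abs_of_nonneg t.2.1]
      exact mul_le_mul_of_nonneg_right t.2.2 (norm_nonneg _))

theorem primitiveL_apply (h : C(I, E)) (t : I) :
    primitiveL E h t = ∫ s in (0 : ℝ)..t, h (projIcc 0 1 zero_le_one s) := rfl

theorem hasDerivWithinAt_of_eq_const_add_primitiveL [CompleteSpace E] {γ h : C(I, E)} {x : E}
    (hγ : γ = ContinuousLinearMap.const ℝ I x + primitiveL E h) {t : ℝ}
    (ht : t ∈ Icc (0 : ℝ) 1) :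
    HasDerivWithinAt (fun s ↦ γ (projIcc 0 1 zero_le_one s))
      (h (projIcc 0 1 zero_le_one t)) (Icc 0 1) t := by
  have hcont : Continuous fun s ↦ h (projIcc 0 1 zero_le_one s) :=
    h.continuous.comp continuous_projIcc
  have hint := ((hcont.integral_hasStrictDerivAt 0 t).hasDerivAt.const_add x).hasDerivWithinAt
    (s := Icc 0 1)
  refine hint.congr_of_mem (fun s hs ↦ ?_) ht
  simp [hγ, primitiveL_apply, projIcc_of_mem _ hs]

theorem apply_zero_of_eq_const_add_primitiveL {γ h : C(I, E)} {x : E}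
    (hγ : γ = ContinuousLinearMap.const ℝ I x + primitiveL E h) : γ 0 = x := by
  simp [hγ, primitiveL_apply]

/-- The operator sending a curve `h` to the vertical variation `t ↦ (0, h t)` of a graph. -/
def verticalL (E : Type*) [NormedAddCommGroup E] [NormedSpace ℝ E] : C(I, E) →L[ℝ] C(I, ℝ × E) :=
  (ContinuousLinearMap.inr ℝ ℝ E).compLeftContinuous ℝ I

theorem graphCurve_eq_verticalL_add :
    (graphCurve : C(I, E) → C(I, ℝ × E)) = fun γ ↦ verticalL E γ + graphCurve 0 := by
  ext γ t <;> simp [verticalL]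

theorem hasFDerivAt_graphCurve (γ : C(I, E)) : HasFDerivAt graphCurve (verticalL E) γ := by
  rw [graphCurve_eq_verticalL_add]
  exact (ContinuousLinearMap.hasFDerivAt _).add_const _

theorem contDiff_graphCurve : ContDiff ℝ ∞ (graphCurve : C(I, E) → C(I, ℝ × E)) := by
  rw [graphCurve_eq_verticalL_add]
  exact (ContinuousLinearMap.contDiff _).add contDiff_const

/-- The defect of a curve `γ` in the integral equation of the time-dependent vector field `f`: it is
the constant curve `x` precisely when `γ` is the integral curve of `f` starting at `x`. -/
def picardDefect (f : C(ℝ × E, E)) (γ : C(I, E)) : C(I, E) :=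
  γ - primitiveL E (f.comp (graphCurve γ))

/-- The integrand of the variational equation along `γ` of a vector field with derivative `f'`. -/
def variationL (f' : C(ℝ × E, ℝ × E →L[ℝ] E)) (γ : C(I, E)) : C(I, E) →L[ℝ] C(I, E) :=
  pointwiseApplyL I (ℝ × E) E (f'.comp (graphCurve γ)) ∘L verticalL E

@[simp]
theorem variationL_apply (f' : C(ℝ × E, ℝ × E →L[ℝ] E)) (γ h : C(I, E)) (t : I) :
    variationL f' γ h t = f' ((t : ℝ), γ t) (0, h t) := rfl

theorem contDiff_picardDefect {f : C(ℝ × E, E)} (hf : ContDiff ℝ ∞ f) :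
    ContDiff ℝ ∞ (picardDefect f) :=
  contDiff_id.sub ((primitiveL E).contDiff.comp
    ((contDiff_superposition f hf).comp contDiff_graphCurve))

theorem hasFDerivAt_picardDefect {f : C(ℝ × E, E)} {f' : C(ℝ × E, ℝ × E →L[ℝ] E)}
    (hf : ∀ p, HasFDerivAt f (f' p) p) (γ : C(I, E)) :
    HasFDerivAt (picardDefect f)
      (ContinuousLinearMap.id ℝ _ - primitiveL E ∘L variationL f' γ) γ :=
  (hasFDerivAt_id γ).sub ((primitiveL E).hasFDerivAt.comp γ
    ((hasFDerivAt_superposition f f' hf (graphCurve γ)).comp γ (hasFDerivAt_graphCurve γ)))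

theorem picardDefect_zero {f : C(ℝ × E, E)} (hf0 : ∀ t, f (t, 0) = 0) : picardDefect f 0 = 0 := by
  have : f.comp (graphCurve 0) = 0 := by ext t; simp [hf0]
  simp [picardDefect, this]

theorem variationL_zero {f' : C(ℝ × E, ℝ × E →L[ℝ] E)} (hf1 : ∀ t v, f' (t, 0) (0, v) = 0) :
    variationL f' 0 = 0 := by
  ext h t
  simp [hf1]

theorem exists_smooth_integralCurves [CompleteSpace E] {f : C(ℝ × E, E)}
    {f' : C(ℝ × E, ℝ × E →L[ℝ] E)} (hf : ContDiff ℝ ∞ f) (hff' : ∀ p, HasFDerivAt f (f' p) p)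
    (hf0 : ∀ t, f (t, 0) = 0) (hf1 : ∀ t v, f' (t, 0) (0, v) = 0) :
    ∃ (U : Set E) (γ : E → C(I, E)), IsOpen U ∧ 0 ∈ U ∧ ContDiffOn ℝ ∞ γ U ∧ γ 0 = 0 ∧
      ∀ x ∈ U, picardDefect f (γ x) = ContinuousLinearMap.const ℝ I x := by
  have hderiv : HasFDerivAt (picardDefect f)
      (ContinuousLinearEquiv.refl ℝ C(I, E) : C(I, E) →L[ℝ] C(I, E)) 0 := by
    have := hasFDerivAt_picardDefect hff' 0
    rwa [variationL_zero hf1, ContinuousLinearMap.comp_zero, sub_zero] at this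
  obtain ⟨e, he, he0, -, -, hes⟩ := exists_openPartialHomeomorph_of_contDiffOn isOpen_univ
    (contDiff_picardDefect hf).contDiffOn (mem_univ 0) _ hderiv
  have he00 : e 0 = 0 := by rw [he, picardDefect_zero hf0]
  let const : E →L[ℝ] C(I, E) := ContinuousLinearMap.const ℝ I
  refine ⟨const ⁻¹' e.target, fun x ↦ e.symm (const x), e.open_target.preimage const.continuous,
    ?_, hes.comp const.contDiff.contDiffOn (fun x hx ↦ hx), ?_, fun x hx ↦ ?_⟩
  · simpa [he00] using e.map_source he0
  · simpa [he00] using e.left_inv he0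
  · rw [← he]
    exact e.right_inv hx

theorem eq_const_add_primitiveL_of_picardDefect {f : C(ℝ × E, E)} {γ : C(I, E)} {x : E}
    (hγ : picardDefect f γ = ContinuousLinearMap.const ℝ I x) :
    γ = ContinuousLinearMap.const ℝ I x + primitiveL E (f.comp (graphCurve γ)) := by
  rw [← hγ, picardDefect, sub_add_cancel]

theorem fderiv_integralCurves_eq_const_add_primitiveL {f : C(ℝ × E, E)}
    {f' : C(ℝ × E, ℝ × E →L[ℝ] E)} (hff' : ∀ p, HasFDerivAt f (f' p) p) {γ : E → C(I, E)} {x : E}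
    (hγd : DifferentiableAt ℝ γ x)
    (hγ : ∀ᶠ y in 𝓝 x, picardDefect f (γ y) = ContinuousLinearMap.const ℝ I y) (v : E) :
    fderiv ℝ γ x v = ContinuousLinearMap.const ℝ I v +
      primitiveL E (variationL f' (γ x) (fderiv ℝ γ x v)) := by
  have hcomp := (hasFDerivAt_picardDefect hff' (γ x)).comp x hγd.hasFDerivAt
  have hconst : HasFDerivAt (picardDefect f ∘ γ) (ContinuousLinearMap.const ℝ I) x :=
    (ContinuousLinearMap.hasFDerivAt _).congr_of_eventuallyEq hγ
  have := DFunLike.congr_fun (hcomp.unique hconst) v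
  rw [← this]
  simp

/-- `φ t`, for `t` between `0` and `1`, is the smooth flow on the neighbourhood `U` of `0` of the
time-dependent vector field `f`, which vanishes to first order at `0`. The variational equation is
part of the definition, as the flow is not assumed to be jointly smooth in time and space. -/
structure IsUnitTimeFlow (f : ℝ × E → E) (U : Set E) (φ : ℝ → E → E) : Prop where
  isOpen : IsOpen U
  zero_mem : 0 ∈ U
  initial : ∀ x ∈ U, φ 0 x = x
  hasDerivWithinAt : ∀ x ∈ U, ∀ t ∈ Icc (0 : ℝ) 1,
    HasDerivWithinAt (fun s ↦ φ s x) (f (t, φ t x)) (Icc 0 1) t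
  contDiffOn : ∀ t, ContDiffOn ℝ ∞ (φ t) U
  hasDerivWithinAt_fderiv : ∀ x ∈ U, ∀ v, ∀ t ∈ Icc (0 : ℝ) 1,
    HasDerivWithinAt (fun s ↦ fderiv ℝ (φ s) x v)
      (fderiv ℝ f (t, φ t x) (0, fderiv ℝ (φ t) x v)) (Icc 0 1) t
  map_zero : ∀ t, φ t 0 = 0
  hasFDerivAt_zero : ∀ t, HasFDerivAt (φ t) (ContinuousLinearMap.id ℝ E) 0
  eventually_forall_mem : ∀ N ∈ 𝓝 (0 : E), ∀ᶠ x in 𝓝 0, ∀ t, φ t x ∈ N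

theorem exists_isUnitTimeFlow [CompleteSpace E] {f : ℝ × E → E} (hf : ContDiff ℝ ∞ f)
    (hf0 : ∀ t, f (t, 0) = 0) (hf1 : ∀ t v, fderiv ℝ f (t, 0) (0, v) = 0) :
    ∃ (U : Set E) (φ : ℝ → E → E), IsUnitTimeFlow f U φ := by
  let fC : C(ℝ × E, E) := ⟨f, hf.continuous⟩
  let f' : C(ℝ × E, ℝ × E →L[ℝ] E) := ⟨fderiv ℝ f, hf.continuous_fderiv (by simp)⟩
  have hff' : ∀ p, HasFDerivAt fC (f' p) p := fun p ↦
    ((hf.differentiable (by simp)) p).hasFDerivAt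
  obtain ⟨U, γ, hU, h0U, hγ, hγ0, hγf⟩ := exists_smooth_integralCurves hf hff' hf0 hf1
  have hγd : ∀ x ∈ U, DifferentiableAt ℝ γ x := fun x hx ↦
    (hγ.contDiffAt (hU.mem_nhds hx)).differentiableAt (by simp)
  have hint := fun x hx ↦ eq_const_add_primitiveL_of_picardDefect (hγf x hx)
  have hvar := fun x hx v ↦ fderiv_integralCurves_eq_const_add_primitiveL hff' (hγd x hx)
    (Filter.mem_of_superset (hU.mem_nhds hx) hγf) v
  let clamp : ℝ → I := projIcc 0 1 zero_le_one
  have hclamp : ∀ t ∈ Icc (0 : ℝ) 1, ((clamp t : I) : ℝ) = t := fun t ht ↦ by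
    simp [clamp, projIcc_of_mem _ ht]
  have hclamp0 : clamp 0 = 0 := projIcc_left _
  have hφ : ∀ t, ∀ x ∈ U, HasFDerivAt (fun x ↦ γ x (clamp t))
      (ContinuousMap.evalCLM ℝ (clamp t) ∘L fderiv ℝ γ x) x := fun t x hx ↦
    (ContinuousMap.evalCLM ℝ (clamp t) : C(I, E) →L[ℝ] E).hasFDerivAt (x := γ x) |>.comp x
      (hγd x hx).hasFDerivAt
  refine ⟨U, fun t x ↦ γ x (clamp t), hU, h0U, fun x hx ↦ ?_, fun x hx t ht ↦ ?_, fun t ↦ ?_,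
    fun x hx v t ht ↦ ?_, fun t ↦ by simp [hγ0], fun t ↦ ?_, fun N hN ↦ ?_⟩
  · simpa only [hclamp0] using apply_zero_of_eq_const_add_primitiveL (hint x hx)
  · refine (hasDerivWithinAt_of_eq_const_add_primitiveL (hint x hx) ht).congr_deriv ?_
    exact congrArg (fun s ↦ f (s, γ x (clamp t))) (hclamp t ht)
  · exact (ContinuousMap.evalCLM ℝ (clamp t)).contDiff.comp_contDiffOn hγ
  · simp only [(hφ _ x hx).fderiv]
    refine (hasDerivWithinAt_of_eq_const_add_primitiveL (hvar x hx v) ht).congr_deriv ?_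
    exact congrArg (fun s ↦ fderiv ℝ f (s, γ x (clamp t)) (0, fderiv ℝ γ x v (clamp t)))
      (hclamp t ht)
  · refine (hφ t 0 h0U).congr_fderiv ?_
    ext v
    have : fderiv ℝ γ 0 v = ContinuousLinearMap.const ℝ I v := by
      simpa [hγ0, variationL_zero (f' := f') hf1] using hvar 0 h0U v
    simp [this]
  · obtain ⟨ε, hε, hεN⟩ := Metric.mem_nhds_iff.1 hN
    filter_upwards [(hγd 0 h0U).continuousAt.preimage_mem_nhds
      (Metric.ball_mem_nhds (γ 0) hε)] with x hx t
    rw [mem_preimage, hγ0] at hx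
    exact hεN ((ContinuousMap.dist_apply_le_dist (f := γ x) (g := 0) (clamp t)).trans_lt hx)

end Flow

/-! ### The radial primitive of a closed two-form -/

section ParametricIntegral

universe u

open unitInterval

variable {E F : Type u} [NormedAddCommGroup E] [NormedSpace ℝ E] [NormedAddCommGroup F]
  [NormedSpace ℝ F]

theorem primitiveL_comp_graphCurve_const_apply_one (g : C(ℝ × E, F)) (y : E) :
    primitiveL F (g.comp (graphCurve (ContinuousLinearMap.const ℝ I y))) 1 =
      ∫ t in (0 : ℝ)..1, g (t, y) := by
  refine intervalIntegral.integral_congr fun s hs ↦ ?_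
  replace hs : s ∈ I := by rwa [uIcc_of_le (by simp)] at hs
  change g (((projIcc 0 1 zero_le_one s : I) : ℝ), y) = g (s, y)
  rw [projIcc_of_mem _ hs]

theorem contDiff_intervalIntegral {g : ℝ × E → F} (hg : ContDiff ℝ ∞ g) :
    ContDiff ℝ ∞ fun y ↦ ∫ t in (0 : ℝ)..1, g (t, y) := by
  have hfun : (fun y ↦ ∫ t in (0 : ℝ)..1, g (t, y)) = fun y ↦
      primitiveL F (ContinuousMap.comp ⟨g, hg.continuous⟩
        (graphCurve (ContinuousLinearMap.const ℝ I y))) 1 :=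
    funext fun y ↦ (primitiveL_comp_graphCurve_const_apply_one ⟨g, hg.continuous⟩ y).symm
  rw [hfun]
  exact (ContinuousMap.evalCLM ℝ (1 : I) ∘L primitiveL F).contDiff.comp
    ((contDiff_superposition ⟨g, hg.continuous⟩ hg).comp
      (contDiff_graphCurve.comp (ContinuousLinearMap.const ℝ I : E →L[ℝ] C(I, E)).contDiff))

theorem fderiv_intervalIntegral {g : ℝ × E → F} (hg : ContDiff ℝ ∞ g) (y u : E) :
    fderiv ℝ (fun y ↦ ∫ t in (0 : ℝ)..1, g (t, y)) y u =
      ∫ t in (0 : ℝ)..1, fderiv ℝ g (t, y) (0, u) := by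
  let gC : C(ℝ × E, F) := ⟨g, hg.continuous⟩
  let g' : C(ℝ × E, ℝ × E →L[ℝ] F) := ⟨fderiv ℝ g, hg.continuous_fderiv (by simp)⟩
  have hcurve : HasFDerivAt (fun z : E ↦ graphCurve (ContinuousLinearMap.const ℝ I z))
      (verticalL E ∘L ContinuousLinearMap.const ℝ I) y :=
    HasFDerivAt.comp (f := (ContinuousLinearMap.const ℝ I : E →L[ℝ] C(I, E))) (g := graphCurve) y
      (hasFDerivAt_graphCurve _) (ContinuousLinearMap.hasFDerivAt _)
  have hcomp := (ContinuousMap.evalCLM ℝ (1 : I) ∘L primitiveL F).hasFDerivAt.comp y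
    ((hasFDerivAt_superposition gC g'
      (fun p ↦ (hg.differentiable (by simp) p).hasFDerivAt) _).comp y hcurve)
  have hfun : (fun y ↦ ∫ t in (0 : ℝ)..1, g (t, y)) = fun y ↦
      primitiveL F (gC.comp (graphCurve (ContinuousLinearMap.const ℝ I y))) 1 :=
    funext fun y ↦ (primitiveL_comp_graphCurve_const_apply_one gC y).symm
  let gu : C(ℝ × E, F) := ⟨fun p ↦ fderiv ℝ g p (0, u), g'.continuous.clm_apply continuous_const⟩
  rw [hfun]
  refine (DFunLike.congr_fun hcomp.fderiv u).trans ?_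
  exact primitiveL_comp_graphCurve_const_apply_one gu y

end ParametricIntegral

section RadialPrimitive

variable {E : Type*} [NormedAddCommGroup E] [NormedSpace ℝ E]

/-- The two-form `β`, written as a field of bilinear forms, is closed at `y`: the left-hand side is
`dβ(u, v, w)` when `β` is skew-symmetric. -/
def IsClosedFormAt (β : E → E →L[ℝ] E →L[ℝ] ℝ) (y : E) : Prop :=
  ∀ u v w, fderiv ℝ β y u v w - fderiv ℝ β y v u w + fderiv ℝ β y w u v = 0

/-- The integrand `t β(ty)(y, ·)` of the radial primitive of `β`. -/
def radialIntegrand (β : E → E →L[ℝ] E →L[ℝ] ℝ) (p : ℝ × E) : E →L[ℝ] ℝ :=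
  p.1 • β (p.1 • p.2) p.2

/-- The primitive of a closed two-form `β` given by the Poincaré lemma for the radial contraction
of the vector space. -/
def radialPrimitive (β : E → E →L[ℝ] E →L[ℝ] ℝ) (y : E) : E →L[ℝ] ℝ :=
  ∫ t in (0 : ℝ)..1, radialIntegrand β (t, y)

variable {β : E → E →L[ℝ] E →L[ℝ] ℝ}

theorem contDiff_radialIntegrand (hβ : ContDiff ℝ ∞ β) : ContDiff ℝ ∞ (radialIntegrand β) :=
  contDiff_fst.smul ((hβ.comp (contDiff_fst.smul contDiff_snd)).clm_apply contDiff_snd)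

theorem fderiv_radialIntegrand (hβ : ContDiff ℝ ∞ β) (t : ℝ) (y u v : E) :
    fderiv ℝ (radialIntegrand β) (t, y) (0, u) v =
      t ^ 2 * fderiv ℝ β (t • y) u y v + t * β (t • y) u v := by
  have htotal : HasFDerivAt (fun z : E ↦ radialIntegrand β (t, z))
      (fderiv ℝ (radialIntegrand β) (t, y) ∘L ContinuousLinearMap.inr ℝ ℝ E) y :=
    ((contDiff_radialIntegrand hβ).differentiable (by simp) _).hasFDerivAt.comp y
      (hasFDerivAt_prodMk_right t y)
  have hscaled : HasFDerivAt (fun z : E ↦ β (t • z))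
      (fderiv ℝ β (t • y) ∘L (t • ContinuousLinearMap.id ℝ E)) y :=
    (hβ.differentiable (by simp) (t • y)).hasFDerivAt.comp y ((hasFDerivAt_id y).const_smul t)
  have hproduct : HasFDerivAt (fun z : E ↦ radialIntegrand β (t, z)) _ y :=
    (hscaled.clm_apply (hasFDerivAt_id y)).const_smul t
  refine (congrArg (fun T ↦ T u v) (htotal.unique hproduct)).trans ?_
  simp
  ring

theorem contDiff_radialPrimitive (hβ : ContDiff ℝ ∞ β) : ContDiff ℝ ∞ (radialPrimitive β) :=
  contDiff_intervalIntegral (contDiff_radialIntegrand hβ)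

theorem radialPrimitive_apply (hβ : ContDiff ℝ ∞ β) (y v : E) :
    radialPrimitive β y v = ∫ t in (0 : ℝ)..1, t * β (t • y) y v := by
  have hcont := (contDiff_radialIntegrand hβ).continuous
  exact ContinuousLinearMap.intervalIntegral_apply
    (Continuous.intervalIntegrable (by fun_prop) _ _) v

theorem fderiv_radialPrimitive (hβ : ContDiff ℝ ∞ β) (y u v : E) :
    fderiv ℝ (radialPrimitive β) y u v =
      ∫ t in (0 : ℝ)..1, (t ^ 2 * fderiv ℝ β (t • y) u y v + t * β (t • y) u v) := by
  have hcont := (contDiff_radialIntegrand hβ).continuous_fderiv (by simp)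
  have hfderiv : fderiv ℝ (radialPrimitive β) y u =
      ∫ t in (0 : ℝ)..1, fderiv ℝ (radialIntegrand β) (t, y) (0, u) :=
    fderiv_intervalIntegral (contDiff_radialIntegrand hβ) y u
  rw [hfderiv, ContinuousLinearMap.intervalIntegral_apply
    (Continuous.intervalIntegrable (by fun_prop) _ _)]
  exact intervalIntegral.integral_congr fun t _ ↦ fderiv_radialIntegrand hβ t y u v

theorem radialPrimitive_zero : radialPrimitive β 0 = 0 := by
  simp [radialPrimitive, radialIntegrand]

theorem fderiv_radialPrimitive_zero (hβ : ContDiff ℝ ∞ β) (h0 : β 0 = 0) :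
    fderiv ℝ (radialPrimitive β) 0 = 0 := by
  ext u v
  simp [fderiv_radialPrimitive hβ, h0]

theorem radialPrimitive_eq_zero_of_isotropic (hβ : ContDiff ℝ ∞ β) {W : Submodule ℝ E}
    (hW : ∀ y ∈ W, ∀ u ∈ W, ∀ v ∈ W, β y u v = 0) {y v : E} (hy : y ∈ W) (hv : v ∈ W) :
    radialPrimitive β y v = 0 := by
  simp [radialPrimitive_apply hβ, fun t : ℝ ↦ hW (t • y) (W.smul_mem t hy) y hy v hv]

theorem hasDerivWithinAt_apply_apply {B : ℝ → E →L[ℝ] E →L[ℝ] ℝ} {B' : E →L[ℝ] E →L[ℝ] ℝ}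
    {a b : ℝ → E} {a' b' : E} {s : Set ℝ} {t : ℝ} (hB : HasDerivWithinAt B B' s t)
    (ha : HasDerivWithinAt a a' s t) (hb : HasDerivWithinAt b b' s t) :
    HasDerivWithinAt (fun r ↦ B r (a r) (b r))
      (B' (a t) (b t) + B t a' (b t) + B t (a t) b') s t := by
  simpa using (hB.clm_apply ha).clm_apply hb

theorem hasDerivAt_comp_apply_apply {c : ℝ → E} {c' : E} {t : ℝ}
    (hβ : DifferentiableAt ℝ β (c t)) (hc : HasDerivAt c c' t) (u v : E) :
    HasDerivAt (fun s ↦ β (c s) u v) (fderiv ℝ β (c t) c' u v) t := by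
  have hcomp : HasDerivAt (fun s ↦ β (c s)) (fderiv ℝ β (c t) c') t :=
    hβ.hasFDerivAt.comp_hasDerivAt t hc
  simpa using (hcomp.clm_apply (hasDerivAt_const t u)).clm_apply (hasDerivAt_const t v)

theorem fderiv_skew {y : E} (hβ : DifferentiableAt ℝ β y) (hskew : ∀ y u v, β y u v = -β y v u)
    (a u v : E) : fderiv ℝ β y a u v = -fderiv ℝ β y a v u := by
  have hβy : DifferentiableAt ℝ β (y + (0 : ℝ) • a) := by simpa using hβ
  have hline : HasDerivAt (fun s : ℝ ↦ y + s • a) a 0 := by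
    simpa using ((hasDerivAt_id (0 : ℝ)).smul_const a).const_add y
  have hswap := (hasDerivAt_comp_apply_apply hβy hline v u).neg.congr_of_eventuallyEq
    (Eventually.of_forall fun s ↦ hskew (y + s • a) u v)
  simpa using (hasDerivAt_comp_apply_apply hβy hline u v).unique hswap

theorem integral_deriv_sq_mul_radial (hβ : ContDiff ℝ ∞ β) (y u v : E) :
    ∫ t in (0 : ℝ)..1, (t ^ 2 * fderiv ℝ β (t • y) y u v + 2 * t * β (t • y) u v) =
      β y u v := by
  have hβ' : Continuous (fderiv ℝ β) := hβ.continuous_fderiv (by simp)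
  have hβc : Continuous β := hβ.continuous
  have hderiv : ∀ t ∈ uIcc (0 : ℝ) 1, HasDerivAt (fun s ↦ s ^ 2 * β (s • y) u v)
      (t ^ 2 * fderiv ℝ β (t • y) y u v + 2 * t * β (t • y) u v) t := by
    intro t _
    have hray : HasDerivAt (fun s : ℝ ↦ s • y) y t := by
      simpa using (hasDerivAt_id t).smul_const y
    refine ((hasDerivAt_pow 2 t).mul (hasDerivAt_comp_apply_apply
      (hβ.differentiable (by simp) (t • y)) hray u v)).congr_deriv ?_
    simp
    ring
  simpa using intervalIntegral.integral_eq_sub_of_hasDerivAt hderiv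
    (Continuous.intervalIntegrable (by fun_prop) _ _)

theorem fderiv_radialPrimitive_sub (hβ : ContDiff ℝ ∞ β) {r : ℝ}
    (hclosed : ∀ y ∈ Metric.ball (0 : E) r, IsClosedFormAt β y)
    (hskew : ∀ y u v, β y u v = -β y v u) {y : E} (hy : y ∈ Metric.ball (0 : E) r) (u v : E) :
    fderiv ℝ (radialPrimitive β) y u v - fderiv ℝ (radialPrimitive β) y v u = β y u v := by
  have hβ' : Continuous (fderiv ℝ β) := hβ.continuous_fderiv (by simp)
  have hβc : Continuous β := hβ.continuous
  rw [fderiv_radialPrimitive hβ, fderiv_radialPrimitive hβ, ← intervalIntegral.integral_sub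
    (Continuous.intervalIntegrable (by fun_prop) _ _)
    (Continuous.intervalIntegrable (by fun_prop) _ _), ← integral_deriv_sq_mul_radial hβ y u v]
  refine intervalIntegral.integral_congr fun t ht ↦ ?_
  rw [uIcc_of_le (by simp)] at ht
  have hty : t • y ∈ Metric.ball (0 : E) r :=
    (convex_ball 0 r).starConvex (Metric.mem_ball_self (Metric.pos_of_mem_ball hy))
      |>.smul_mem hy ht.1 ht.2
  linear_combination t ^ 2 * hclosed _ hty u y v
    - t ^ 2 * fderiv_skew (hβ.differentiable (by simp) _) hskew v u y - t * hskew (t • y) v u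

end RadialPrimitive

/-! ### Moser's argument -/

section LagrangianSubspace

variable {E : Type*} [NormedAddCommGroup E] [NormedSpace ℝ E]

/-- Inside `U`, the linear subspace `W` is a Lagrangian submanifold for the two-form `η`. -/
structure IsLagrangianOn (η : E → E →L[ℝ] E →L[ℝ] ℝ) (U : Set E) (W : Submodule ℝ E) : Prop where
  half_dim : 2 * Module.finrank ℝ W = Module.finrank ℝ E
  isotropic : ∀ y ∈ W, y ∈ U → ∀ u ∈ W, ∀ v ∈ W, η y u v = 0

theorem eq_zero_of_isInvertible {B : E →L[ℝ] E →L[ℝ] ℝ} (hB : B.IsInvertible) {u : E}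
    (hu : ∀ v, B u v = 0) : u = 0 :=
  hB.injective ((ContinuousLinearMap.ext hu).trans (map_zero B).symm)

theorem mem_of_isotropic_of_half_dim [FiniteDimensional ℝ E] {B : E →L[ℝ] E →L[ℝ] ℝ}
    (hB : B.IsInvertible) (hskew : ∀ u v, B u v = -B v u) {W : Submodule ℝ E}
    (hdim : 2 * Module.finrank ℝ W = Module.finrank ℝ E)
    (hW : ∀ u ∈ W, ∀ v ∈ W, B u v = 0) {z : E} (hz : ∀ w ∈ W, B z w = 0) : z ∈ W := by
  let b : LinearMap.BilinForm ℝ E :=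
    (ContinuousLinearMap.coeLM ℝ : (E →L[ℝ] ℝ) →ₗ[ℝ] E →ₗ[ℝ] ℝ) ∘ₗ B.toLinearMap
  have hb : b.Nondegenerate :=
    ⟨fun u hu ↦ eq_zero_of_isInvertible hB hu, fun u hu ↦ eq_zero_of_isInvertible hB fun v ↦ by
      rw [hskew, neg_eq_zero]
      exact hu v⟩
  have hfinrank := LinearMap.BilinForm.finrank_orthogonal hb W
  have hle : W ≤ b.orthogonal W := fun u hu v hv ↦ hW v hv u hu
  rw [Submodule.eq_of_le_of_finrank_eq hle (by omega)]
  intro w hw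
  change B w z = 0
  rw [hskew, hz w hw, neg_zero]

end LagrangianSubspace

section InvariantSubspace

variable {E : Type*} [NormedAddCommGroup E] [NormedSpace ℝ E]

theorem apply_one_eq_zero_of_norm_deriv_le {w w' : ℝ → E} {K : ℝ}
    (hw : ∀ t ∈ Icc (0 : ℝ) 1, HasDerivWithinAt w (w' t) (Icc 0 1) t)
    (hK : ∀ t ∈ Icc (0 : ℝ) 1, ‖w' t‖ ≤ K * ‖w t‖) (h0 : w 0 = 0) : w 1 = 0 := by
  refine eq_zero_of_abs_deriv_le_mul_abs_self_of_eq_zero_right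
    (fun t ht ↦ (hw t ht).continuousWithinAt) (fun t ht ↦ ?_) h0
    (fun t ht ↦ hK t (Ico_subset_Icc_self ht)) 1 (by simp)
  exact (hw t (Ico_subset_Icc_self ht)).mono_of_mem_nhdsWithin (Icc_mem_nhdsGE_of_mem ht)

theorem apply_one_eq_zero_iff_of_norm_deriv_le {w w' : ℝ → E} {K : ℝ}
    (hw : ∀ t ∈ Icc (0 : ℝ) 1, HasDerivWithinAt w (w' t) (Icc 0 1) t)
    (hK : ∀ t ∈ Icc (0 : ℝ) 1, ‖w' t‖ ≤ K * ‖w t‖) : w 1 = 0 ↔ w 0 = 0 := by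
  refine ⟨fun h1 ↦ ?_, apply_one_eq_zero_of_norm_deriv_le hw hK⟩
  have hmaps : MapsTo (fun s : ℝ ↦ 1 - s) (Icc 0 1) (Icc 0 1) := fun s hs ↦
    ⟨by linarith [hs.2], by linarith [hs.1]⟩
  have hreverse : ∀ t ∈ Icc (0 : ℝ) 1,
      HasDerivWithinAt (fun s ↦ w (1 - s)) (-w' (1 - t)) (Icc 0 1) t := fun t ht ↦ by
    simpa [Function.comp_def] using (hw (1 - t) (hmaps ht)).scomp t
      ((hasDerivAt_id t).const_sub 1).hasDerivWithinAt hmaps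
  simpa using apply_one_eq_zero_of_norm_deriv_le hreverse
    (fun t ht ↦ by simpa using hK (1 - t) (hmaps ht)) (by simpa using h1)

theorem exists_norm_sub_le_of_contDiff {f : ℝ × E → E} (hf : ContDiff ℝ 1 f) {γ δ : ℝ → E}
    (hγ : ContinuousOn γ (Icc 0 1)) (hδ : ContinuousOn δ (Icc 0 1)) :
    ∃ K : ℝ, ∀ t ∈ Icc (0 : ℝ) 1, ‖f (t, γ t) - f (t, δ t)‖ ≤ K * ‖γ t - δ t‖ := by
  let graph (c : ℝ → E) : Set (ℝ × E) := (fun t ↦ (t, c t)) '' Icc 0 1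
  have hcompact (c : ℝ → E) (hc : ContinuousOn c (Icc 0 1)) : IsCompact (graph c) :=
    isCompact_Icc.image_of_continuousOn (continuousOn_id.prodMk hc)
  obtain ⟨K, hK⟩ := hf.locallyLipschitz.locallyLipschitzOn.exists_lipschitzOnWith_of_compact
    ((hcompact γ hγ).union (hcompact δ hδ))
  refine ⟨K, fun t ht ↦ (hK.norm_sub_le (Or.inl (mem_image_of_mem _ ht))
    (Or.inr (mem_image_of_mem _ ht))).trans_eq ?_⟩
  simp [Prod.norm_def]

theorem mem_submodule_iff_of_hasDerivWithinAt {f : ℝ × E → E} (hf : ContDiff ℝ 1 f)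
    {W : Submodule ℝ E} (hWc : W.ClosedComplemented) (hW : ∀ t, ∀ y ∈ W, f (t, y) ∈ W)
    {γ : ℝ → E} (hγ : ∀ t ∈ Icc (0 : ℝ) 1, HasDerivWithinAt γ (f (t, γ t)) (Icc 0 1) t) :
    γ 1 ∈ W ↔ γ 0 ∈ W := by
  obtain ⟨P, hP⟩ := hWc
  let π : E →L[ℝ] E := ContinuousLinearMap.id ℝ E - W.subtypeL ∘L P
  have hsub (x : E) : x - π x ∈ W := by simp [π]
  have hπ (x : E) : π x = 0 ↔ x ∈ W :=
    ⟨fun h ↦ by simpa [h] using hsub x, fun h ↦ by simp [π, hP ⟨x, h⟩]⟩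
  have hγc : ContinuousOn γ (Icc 0 1) := fun t ht ↦ (hγ t ht).continuousWithinAt
  obtain ⟨K, hK⟩ := exists_norm_sub_le_of_contDiff hf hγc
    (hγc.sub (π.continuous.comp_continuousOn hγc))
  have hbound : ∀ t ∈ Icc (0 : ℝ) 1, ‖π (f (t, γ t))‖ ≤ (‖π‖ * K) * ‖π (γ t)‖ := by
    intro t ht
    have hproj : π (f (t, γ t)) = π (f (t, γ t) - f (t, γ t - π (γ t))) := by
      rw [map_sub, (hπ _).2 (hW t _ (hsub _)), sub_zero]
    rw [hproj, mul_assoc]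
    exact π.le_opNorm_of_le (by simpa using hK t ht)
  rw [← hπ, ← hπ]
  exact apply_one_eq_zero_iff_of_norm_deriv_le
    (fun t ht ↦ π.hasFDerivAt.comp_hasDerivWithinAt t (hγ t ht)) hbound

end InvariantSubspace

section Moser

universe u

variable {E : Type u} [NormedAddCommGroup E] [NormedSpace ℝ E]

theorem hasDerivAt_comp_line {F : Type*} [NormedAddCommGroup F] [NormedSpace ℝ F] {g : E → F}
    {x : E} (hg : DifferentiableAt ℝ g x) (v : E) :
    HasDerivAt (fun r : ℝ ↦ g (x + r • v)) (fderiv ℝ g x v) 0 :=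
  hg.hasFDerivAt.hasLineDerivAt v

/-- The path of two-forms joining the constant form `η 0` to `η`. -/
def moserForm (η : E → E →L[ℝ] E →L[ℝ] ℝ) (p : ℝ × E) : E →L[ℝ] E →L[ℝ] ℝ :=
  η 0 + Real.smoothTransition p.1 • (η p.2 - η 0)

/-- The primitive of `η - η 0` used in Moser's argument. -/
def moserPrimitive (η : E → E →L[ℝ] E →L[ℝ] ℝ) : E → E →L[ℝ] ℝ :=
  radialPrimitive fun y ↦ η y - η 0

/-- Moser's time-dependent vector field, along whose flow `moserForm η` is constant. -/
def moserField (η : E → E →L[ℝ] E →L[ℝ] ℝ) (p : ℝ × E) : E :=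
  -(deriv Real.smoothTransition p.1) • (moserForm η p).inverse (moserPrimitive η p.2)

variable {η : E → E →L[ℝ] E →L[ℝ] ℝ}

theorem contDiff_moserForm (hη : ContDiff ℝ ∞ η) : ContDiff ℝ ∞ (moserForm η) :=
  contDiff_const.add ((Real.smoothTransition.contDiff.comp contDiff_fst).smul
    ((hη.comp contDiff_snd).sub contDiff_const))

theorem moserForm_skew (hskew : ∀ y u v, η y u v = -η y v u) (p : ℝ × E) (u v : E) :
    moserForm η p u v = -moserForm η p v u := by
  simp only [moserForm, _root_.add_apply, _root_.smul_apply, _root_.sub_apply, smul_eq_mul]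
  rw [hskew 0 u v, hskew p.2 u v]
  ring

theorem fderiv_moserForm (hη : ContDiff ℝ ∞ η) (t s : ℝ) (y u : E) :
    fderiv ℝ (moserForm η) (t, y) (s, u) =
      (s * deriv Real.smoothTransition t) • (η y - η 0) +
        Real.smoothTransition t • fderiv ℝ η y u := by
  have hτ : HasDerivAt (fun r : ℝ ↦ Real.smoothTransition (t + r • s))
      (fderiv ℝ Real.smoothTransition t s) 0 :=
    hasDerivAt_comp_line ((Real.smoothTransition.contDiff (n := 1)).differentiable (by simp) t) s
  have hηline : HasDerivAt (fun r : ℝ ↦ η (y + r • u)) (fderiv ℝ η y u) 0 :=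
    hasDerivAt_comp_line (hη.differentiable (by simp) y) u
  have htotal : HasDerivAt (fun r : ℝ ↦ moserForm η ((t, y) + r • ((s, u) : ℝ × E)))
      (fderiv ℝ (moserForm η) (t, y) (s, u)) 0 :=
    hasDerivAt_comp_line ((contDiff_moserForm hη).differentiable (by simp) _) _
  have hproduct : HasDerivAt (fun r : ℝ ↦ moserForm η ((t, y) + r • ((s, u) : ℝ × E))) _ 0 :=
    (hτ.smul (hηline.sub_const (η 0))).const_add (η 0)
  rw [htotal.unique hproduct, fderiv_eq_smul_deriv, smul_eq_mul]
  simp [add_comm]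

theorem contDiff_moserPrimitive (hη : ContDiff ℝ ∞ η) : ContDiff ℝ ∞ (moserPrimitive η) :=
  contDiff_radialPrimitive (hη.sub contDiff_const)

theorem fderiv_moserPrimitive_sub (hη : ContDiff ℝ ∞ η) (hskew : ∀ y u v, η y u v = -η y v u)
    {r : ℝ} (hclosed : ∀ y ∈ Metric.ball (0 : E) r, IsClosedFormAt η y) {y : E}
    (hy : y ∈ Metric.ball (0 : E) r) (u v : E) :
    fderiv ℝ (moserPrimitive η) y u v - fderiv ℝ (moserPrimitive η) y v u = (η y - η 0) u v := by
  refine fderiv_radialPrimitive_sub (hη.sub contDiff_const) (r := r) (fun y hy ↦ ?_)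
    (fun y u v ↦ ?_) hy u v
  · simpa only [IsClosedFormAt, fderiv_sub_const] using hclosed y hy
  · simp only [_root_.sub_apply]
    rw [hskew y u v, hskew 0 u v]
    ring

theorem contDiff_moserField [CompleteSpace E] (hη : ContDiff ℝ ∞ η)
    (hinv : ∀ p, (moserForm η p).IsInvertible) : ContDiff ℝ ∞ (moserField η) := by
  have hτ : ContDiff ℝ ∞ (deriv Real.smoothTransition) :=
    (contDiff_infty_iff_deriv.1 Real.smoothTransition.contDiff).2
  have hinverse : ContDiff ℝ ∞ fun p ↦ (moserForm η p).inverse :=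
    contDiff_iff_contDiffAt.2 fun p ↦ ContDiffAt.comp p (hinv p).contDiffAt_map_inverse
      (contDiff_moserForm hη).contDiffAt
  exact (hτ.comp contDiff_fst).neg.smul
    (hinverse.clm_apply ((contDiff_moserPrimitive hη).comp contDiff_snd))

theorem moserForm_moserField (hinv : ∀ p, (moserForm η p).IsInvertible) (p : ℝ × E) :
    moserForm η p (moserField η p) =
      -(deriv Real.smoothTransition p.1) • moserPrimitive η p.2 := by
  rw [moserField, map_smul, (hinv p).self_apply_inverse]

theorem fderiv_moserForm_moserField [CompleteSpace E] (hη : ContDiff ℝ ∞ η)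
    (hinv : ∀ p, (moserForm η p).IsInvertible) (t : ℝ) (y a : E) :
    fderiv ℝ (moserForm η) (t, y) (0, a) (moserField η (t, y)) +
      moserForm η (t, y) (fderiv ℝ (moserField η) (t, y) (0, a)) =
      -(deriv Real.smoothTransition t) • fderiv ℝ (moserPrimitive η) y a := by
  have hproduct : HasDerivAt (fun r : ℝ ↦ moserForm η ((t, y) + r • ((0, a) : ℝ × E))
      (moserField η ((t, y) + r • ((0, a) : ℝ × E)))) _ 0 :=
    (hasDerivAt_comp_line ((contDiff_moserForm hη).differentiable (by simp) (t, y))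
      (0, a)).clm_apply
    (hasDerivAt_comp_line ((contDiff_moserField hη hinv).differentiable (by simp) (t, y)) (0, a))
  have hprimitive : HasDerivAt (fun r : ℝ ↦ -(deriv Real.smoothTransition t) •
      moserPrimitive η (y + r • a)) _ 0 :=
    (hasDerivAt_comp_line ((contDiff_moserPrimitive hη).differentiable (by simp) y) a).const_smul
      (-(deriv Real.smoothTransition t))
  simpa using hproduct.unique (hprimitive.congr_of_eventuallyEq (Eventually.of_forall fun r ↦ by
    simp only [moserForm_moserField hinv]
    simp))

theorem moserField_zero (t : ℝ) : moserField η (t, 0) = 0 := by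
  simp [moserField, moserPrimitive, radialPrimitive_zero]

theorem fderiv_moserField_zero [CompleteSpace E] (hη : ContDiff ℝ ∞ η)
    (hinv : ∀ p, (moserForm η p).IsInvertible) (t : ℝ) (v : E) :
    fderiv ℝ (moserField η) (t, 0) (0, v) = 0 := by
  have hprimitive : fderiv ℝ (moserPrimitive η) 0 = 0 :=
    fderiv_radialPrimitive_zero (hη.sub contDiff_const) (sub_self _)
  have hfield := fderiv_moserForm_moserField hη hinv t 0 v
  rw [moserField_zero, map_zero, zero_add, hprimitive, _root_.zero_apply, smul_zero] at hfield
  exact (hinv (t, 0)).injective (hfield.trans (map_zero _).symm)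

theorem moserForm_lieDeriv_moserField_eq_zero [CompleteSpace E] (hη : ContDiff ℝ ∞ η)
    (hskew : ∀ y u v, η y u v = -η y v u) (hinv : ∀ p, (moserForm η p).IsInvertible) {r : ℝ}
    (hclosed : ∀ y ∈ Metric.ball (0 : E) r, IsClosedFormAt η y)
    {y : E} (hy : y ∈ Metric.ball (0 : E) r) (t : ℝ) (a b : E) :
    fderiv ℝ (moserForm η) (t, y) (1, moserField η (t, y)) a b +
      moserForm η (t, y) (fderiv ℝ (moserField η) (t, y) (0, a)) b +
      moserForm η (t, y) a (fderiv ℝ (moserField η) (t, y) (0, b)) = 0 := by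
  have hprimitive := fderiv_moserPrimitive_sub hη hskew hclosed hy a b
  have hfield_a := congrArg (fun T ↦ T b) (fderiv_moserForm_moserField hη hinv t y a)
  have hfield_b := congrArg (fun T ↦ T a) (fderiv_moserForm_moserField hη hinv t y b)
  have hclosed_y := hclosed y hy (moserField η (t, y)) a b
  rw [moserForm_skew hskew (t, y) a]
  simp only [fderiv_moserForm hη, _root_.add_apply, _root_.smul_apply, smul_eq_mul, zero_mul,
    zero_smul, zero_add, one_mul] at hfield_a hfield_b ⊢
  linear_combination Real.smoothTransition t * hclosed_y + hfield_a - hfield_b -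
    deriv Real.smoothTransition t * hprimitive

theorem moserField_mem [FiniteDimensional ℝ E] (hη : ContDiff ℝ ∞ η)
    (hskew : ∀ y u v, η y u v = -η y v u) (hinv : ∀ p, (moserForm η p).IsInvertible)
    {W : Submodule ℝ E} (hW : IsLagrangianOn η univ W) (t : ℝ) {y : E} (hy : y ∈ W) :
    moserField η (t, y) ∈ W := by
  have hdiff : ∀ y ∈ W, ∀ u ∈ W, ∀ v ∈ W, (η y - η 0) u v = 0 := fun y hy u hu v hv ↦ by
    simp [hW.isotropic 0 W.zero_mem (mem_univ 0) u hu v hv,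
      hW.isotropic y hy (mem_univ y) u hu v hv]
  refine mem_of_isotropic_of_half_dim (hinv (t, y)) (moserForm_skew hskew _) hW.half_dim
    (fun u hu v hv ↦ ?_) (fun w hw ↦ ?_)
  · simp [moserForm, hW.isotropic 0 W.zero_mem (mem_univ 0) u hu v hv,
      hW.isotropic y hy (mem_univ y) u hu v hv]
  · simp [moserForm_moserField hinv, moserPrimitive,
      radialPrimitive_eq_zero_of_isotropic (hη.sub contDiff_const) hdiff hy hw]

theorem moser_pullback_eq [CompleteSpace E] (hη : ContDiff ℝ ∞ η)
    (hskew : ∀ y u v, η y u v = -η y v u) (hinv : ∀ p, (moserForm η p).IsInvertible) {r : ℝ}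
    (hclosed : ∀ y ∈ Metric.ball (0 : E) r, IsClosedFormAt η y) {U : Set E} {φ : ℝ → E → E}
    (hφ : IsUnitTimeFlow (moserField η) U φ) {x : E} (hx : x ∈ U)
    (hball : ∀ t, φ t x ∈ Metric.ball (0 : E) r) (u v : E) :
    η (φ 1 x) (fderiv ℝ (φ 1) x u) (fderiv ℝ (φ 1) x v) = η 0 u v := by
  let pullback : ℝ → ℝ := fun t ↦ moserForm η (t, φ t x) (fderiv ℝ (φ t) x u) (fderiv ℝ (φ t) x v)
  have hderiv : ∀ t ∈ Icc (0 : ℝ) 1, HasDerivWithinAt pullback 0 (Icc 0 1) t := by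
    intro t ht
    have hcurve : HasDerivWithinAt (fun s ↦ (s, φ s x)) (1, moserField η (t, φ t x)) (Icc 0 1) t :=
      (hasDerivWithinAt_id t _).prodMk (hφ.hasDerivWithinAt x hx t ht)
    have hform : HasDerivWithinAt (fun s ↦ moserForm η (s, φ s x))
        (fderiv ℝ (moserForm η) (t, φ t x) (1, moserField η (t, φ t x))) (Icc 0 1) t :=
      ((contDiff_moserForm hη).differentiable (by simp) (t, φ t x)).hasFDerivAt
        |>.comp_hasDerivWithinAt (f := fun s ↦ (s, φ s x)) t hcurve
    exact (hasDerivWithinAt_apply_apply hform (hφ.hasDerivWithinAt_fderiv x hx u t ht)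
      (hφ.hasDerivWithinAt_fderiv x hx v t ht)).congr_deriv
      (moserForm_lieDeriv_moserField_eq_zero hη hskew hinv hclosed (hball t) t _ _)
  have hconst : pullback 1 = pullback 0 := constant_of_derivWithin_zero
    (fun t ht ↦ (hderiv t ht).differentiableWithinAt)
    (fun t ht ↦ (hderiv t (Ico_subset_Icc_self ht)).derivWithin
      (uniqueDiffOn_Icc zero_lt_one t (Ico_subset_Icc_self ht))) 1 (by simp)
  have hinitial : φ 0 =ᶠ[𝓝 x] id := by
    filter_upwards [hφ.isOpen.mem_nhds hx] with y hy using hφ.initial y hy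
  simpa [pullback, moserForm, hinitial.fderiv_eq] using hconst

theorem exists_moser_chart [FiniteDimensional ℝ E] (hη : ContDiff ℝ ∞ η)
    (hskew : ∀ y u v, η y u v = -η y v u) (hinv : ∀ p, (moserForm η p).IsInvertible) {r : ℝ}
    (hr : 0 < r) (hclosed : ∀ y ∈ Metric.ball (0 : E) r, IsClosedFormAt η y) :
    ∃ e : OpenPartialHomeomorph E E, 0 ∈ e.source ∧ e 0 = 0 ∧ e.target ⊆ Metric.ball 0 r ∧
      ContDiffOn ℝ ∞ e e.source ∧ ContDiffOn ℝ ∞ e.symm e.target ∧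
      (∀ x ∈ e.source, ∀ u v, η (e x) (fderiv ℝ e x u) (fderiv ℝ e x v) = η 0 u v) ∧
      ∀ W : Submodule ℝ E, IsLagrangianOn η univ W → ∀ x ∈ e.source, (e x ∈ W ↔ x ∈ W) := by
  have := FiniteDimensional.complete ℝ E
  have hfield := contDiff_moserField hη hinv
  obtain ⟨U, φ, hφ⟩ :=
    exists_isUnitTimeFlow hfield moserField_zero (fderiv_moserField_zero hη hinv)
  obtain ⟨N, hN, hNo, h0N⟩ :=
    eventually_nhds_iff.1 (hφ.eventually_forall_mem _ (Metric.ball_mem_nhds 0 hr))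
  obtain ⟨e, he, h0e, heU, -, hes⟩ := exists_openPartialHomeomorph_of_contDiffOn
    (hφ.isOpen.inter hNo) ((hφ.contDiffOn 1).mono inter_subset_left) ⟨hφ.zero_mem, h0N⟩
    (ContinuousLinearEquiv.refl ℝ E) (hφ.hasFDerivAt_zero 1)
  have htarget : e.target ⊆ Metric.ball 0 r := fun y hy ↦ by
    rw [← e.right_inv hy, he]
    exact hN _ (heU (e.map_target hy)).2 1
  refine ⟨e, h0e, by rw [he, hφ.map_zero], htarget, ?_, hes, fun x hx u v ↦ ?_, fun W hW x hx ↦ ?_⟩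
  · rw [he]
    exact (hφ.contDiffOn 1).mono fun x hx ↦ (heU hx).1
  · rw [he]
    exact moser_pullback_eq hη hskew hinv hclosed hφ (heU hx).1 (hN x (heU hx).2) u v
  · have hflow := mem_submodule_iff_of_hasDerivWithinAt (hfield.of_le (by simp))
      (Submodule.ClosedComplemented.of_finiteDimensional W)
      (fun t y hy ↦ moserField_mem hη hskew hinv hW t hy) (hφ.hasDerivWithinAt x (heU hx).1)
    rwa [hφ.initial x (heU hx).1, ← he] at hflow

end Moser

/-! ### The relative Darboux theorem in a vector space -/

section Cutoff

variable {E : Type*} [NormedAddCommGroup E] [NormedSpace ℝ E] [HasContDiffBump E]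
  {χ : ContDiffBump (0 : E)} {η : E → E →L[ℝ] E →L[ℝ] ℝ} {U : Set E}

/-- The two-form which agrees with `η` near the origin and with the constant form `η 0` away from
the support of the bump function `χ`. -/
def cutoffForm (χ : ContDiffBump (0 : E)) (η : E → E →L[ℝ] E →L[ℝ] ℝ) (y : E) :
    E →L[ℝ] E →L[ℝ] ℝ :=
  η 0 + χ y • (η y - η 0)

theorem cutoffForm_of_mem_closedBall {y : E} (hy : y ∈ Metric.closedBall 0 χ.rIn) :
    cutoffForm χ η y = η y := by
  simp [cutoffForm, χ.one_of_mem_closedBall hy]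

theorem mem_ball_or_contDiffBump_eq_zero (χ : ContDiffBump (0 : E)) (y : E) :
    y ∈ Metric.ball (0 : E) χ.rOut ∨ χ y = 0 := by
  rw [← χ.support_eq, Function.mem_support]
  exact ne_or_eq _ _

theorem contDiff_cutoffForm (hU : IsOpen U) (hη : ContDiffOn ℝ ∞ η U)
    (hχ : Metric.closedBall 0 χ.rOut ⊆ U) : ContDiff ℝ ∞ (cutoffForm χ η) := by
  refine contDiff_const.add (contDiff_iff_contDiffAt.2 fun y ↦ ?_)
  by_cases hy : y ∈ tsupport χ
  · exact χ.contDiff.contDiffAt.smul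
      ((hη.contDiffAt (hU.mem_nhds (hχ (χ.tsupport_eq ▸ hy)))).sub contDiffAt_const)
  · refine (contDiffAt_const (c := 0)).congr_of_eventuallyEq ?_
    filter_upwards [notMem_tsupport_iff_eventuallyEq.1 hy] with z hz
    simp [hz]

theorem cutoffForm_skew (hskew : ∀ y ∈ U, ∀ u v, η y u v = -η y v u) (h0 : 0 ∈ U)
    (hχ : Metric.ball 0 χ.rOut ⊆ U) (y u v : E) :
    cutoffForm χ η y u v = -cutoffForm χ η y v u := by
  rcases mem_ball_or_contDiffBump_eq_zero χ y with hy | hy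
  · simp only [cutoffForm, _root_.add_apply, _root_.smul_apply, _root_.sub_apply, smul_eq_mul]
    rw [hskew y (hχ hy) u v, hskew 0 h0 u v]
    ring
  · simp [cutoffForm, hy, hskew 0 h0 u v]

theorem IsLagrangianOn.cutoffForm {W : Submodule ℝ E} (hW : IsLagrangianOn η U W) (h0 : 0 ∈ U)
    (hχ : Metric.ball 0 χ.rOut ⊆ U) : IsLagrangianOn (cutoffForm χ η) univ W := by
  refine ⟨hW.half_dim, fun y hyW _ u hu v hv ↦ ?_⟩
  rcases mem_ball_or_contDiffBump_eq_zero χ y with hy | hy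
  · simp [_root_.cutoffForm, hW.isotropic 0 W.zero_mem h0 u hu v hv,
      hW.isotropic y hyW (hχ hy) u hu v hv]
  · simp [_root_.cutoffForm, hy, hW.isotropic 0 W.zero_mem h0 u hu v hv]

theorem moserForm_cutoffForm (p : ℝ × E) :
    moserForm (cutoffForm χ η) p =
      η 0 + (Real.smoothTransition p.1 * χ p.2) • (η p.2 - η 0) := by
  simp [moserForm, cutoffForm, mul_smul]

theorem moserForm_cutoffForm_mem_ball {ε : ℝ} (hε : 0 < ε)
    (hχ : ∀ y ∈ Metric.ball 0 χ.rOut, η y ∈ Metric.ball (η 0) ε) (p : ℝ × E) :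
    moserForm (cutoffForm χ η) p ∈ Metric.ball (η 0) ε := by
  rw [moserForm_cutoffForm, mem_ball_iff_norm, add_sub_cancel_left]
  rcases mem_ball_or_contDiffBump_eq_zero χ p.2 with hp | hp
  · have hweight : ‖Real.smoothTransition p.1 * χ p.2‖ ≤ 1 := by
      rw [Real.norm_of_nonneg (mul_nonneg (Real.smoothTransition.nonneg _) χ.nonneg)]
      exact mul_le_one₀ (Real.smoothTransition.le_one _) χ.nonneg χ.le_one
    rw [norm_smul]
    exact (mul_le_of_le_one_left (norm_nonneg _) hweight).trans_lt
      (mem_ball_iff_norm.1 (hχ _ hp))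
  · simpa [hp] using hε

end Cutoff

section Darboux

universe u

variable {E : Type u} [NormedAddCommGroup E] [NormedSpace ℝ E]

theorem eventually_isInvertible {W : Type*} [NormedAddCommGroup W] [NormedSpace ℝ W]
    [CompleteSpace E] {f : E →L[ℝ] W} (hf : f.IsInvertible) : ∀ᶠ f' in 𝓝 f, f'.IsInvertible := by
  obtain ⟨a, rfl⟩ := hf
  exact a.nhds

variable [FiniteDimensional ℝ E] {U : Set E} {η : E → E →L[ℝ] E →L[ℝ] ℝ}

theorem exists_cutoffForm_isInvertible (hU : U ∈ 𝓝 0) (hη : ContinuousAt η 0)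
    (hinv : (η 0).IsInvertible) :
    ∃ χ : ContDiffBump (0 : E), Metric.closedBall 0 χ.rOut ⊆ U ∧
      ∀ p, (moserForm (cutoffForm χ η) p).IsInvertible := by
  have := FiniteDimensional.complete ℝ E
  obtain ⟨ε, hε, hball⟩ := Metric.mem_nhds_iff.1 (eventually_isInvertible hinv)
  obtain ⟨R, hR, hRU⟩ := Metric.nhds_basis_closedBall.mem_iff.1
    (inter_mem (hη.preimage_mem_nhds (Metric.ball_mem_nhds _ hε)) hU)
  obtain ⟨χ, rfl⟩ : ∃ χ : ContDiffBump (0 : E), χ.rOut = R :=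
    ⟨⟨R / 2, R, half_pos hR, half_lt_self hR⟩, rfl⟩
  exact ⟨χ, fun y hy ↦ (hRU hy).2, fun p ↦ hball (moserForm_cutoffForm_mem_ball hε
    (fun y hy ↦ (hRU (Metric.ball_subset_closedBall hy)).1) p)⟩

theorem exists_relative_darboux_chart (hU : IsOpen U) (h0 : 0 ∈ U) (hη : ContDiffOn ℝ ∞ η U)
    (hskew : ∀ y ∈ U, ∀ u v, η y u v = -η y v u) (hinv : (η 0).IsInvertible)
    (hclosed : ∀ y ∈ U, IsClosedFormAt η y) :
    ∃ e : OpenPartialHomeomorph E E, 0 ∈ e.source ∧ e 0 = 0 ∧ e.target ⊆ U ∧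
      ContDiffOn ℝ ∞ e e.source ∧ ContDiffOn ℝ ∞ e.symm e.target ∧
      (∀ x ∈ e.source, ∀ u v, η (e x) (fderiv ℝ e x u) (fderiv ℝ e x v) = η 0 u v) ∧
      ∀ W : Submodule ℝ E, IsLagrangianOn η U W → ∀ x ∈ e.source, (e x ∈ W ↔ x ∈ W) := by
  obtain ⟨χ, hχU, hχinv⟩ := exists_cutoffForm_isInvertible (hU.mem_nhds h0)
    (hη.continuousOn.continuousAt (hU.mem_nhds h0)) hinv
  have hballU : Metric.ball 0 χ.rOut ⊆ U := Metric.ball_subset_closedBall.trans hχU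
  have hagree : ∀ y ∈ Metric.ball 0 χ.rIn, cutoffForm χ η y = η y := fun y hy ↦
    cutoffForm_of_mem_closedBall (Metric.ball_subset_closedBall hy)
  have hrInU : Metric.ball 0 χ.rIn ⊆ U := (Metric.ball_subset_ball χ.rIn_lt_rOut.le).trans hballU
  have hclosed' : ∀ y ∈ Metric.ball 0 χ.rIn, IsClosedFormAt (cutoffForm χ η) y := fun y hy ↦ by
    have hnear : cutoffForm χ η =ᶠ[𝓝 y] η := by
      filter_upwards [Metric.isOpen_ball.mem_nhds hy] with z hz using hagree z hz
    rw [IsClosedFormAt, hnear.fderiv_eq]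
    exact hclosed y (hrInU hy)
  obtain ⟨e, h0e, he0, het, hes, hest, hpull, hW⟩ := exists_moser_chart
    (contDiff_cutoffForm hU hη hχU) (cutoffForm_skew hskew h0 hballU) hχinv χ.rIn_pos hclosed'
  refine ⟨e, h0e, he0, het.trans hrInU, hes, hest, fun x hx u v ↦ ?_, fun W hLag ↦
    hW W (hLag.cutoffForm h0 hballU)⟩
  rw [← hagree _ (het (e.map_source hx)), ← hagree 0 (Metric.mem_ball_self χ.rIn_pos)]
  exact hpull x hx u v

end Darboux

section TwoFormToBilin

variable (E : Type*) [NormedAddCommGroup E] [NormedSpace ℝ E]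

/-- The continuous bilinear form associated with an alternating two-form. -/
def twoFormToBilinL : (E [⋀^Fin 2]→L[ℝ] ℝ) →L[ℝ] E →L[ℝ] E →L[ℝ] ℝ :=
  ContinuousLinearMap.compL ℝ E (E [⋀^Fin 1]→L[ℝ] ℝ) (E →L[ℝ] ℝ)
      (ContinuousAlternatingMap.ofSubsingletonLIE (𝕜 := ℝ) (E := E) (F := ℝ)
        (0 : Fin 1)).symm.toContinuousLinearEquiv ∘L
    (ContinuousAlternatingMap.curryLeftLI (𝕜 := ℝ) (E := E) (F := ℝ)).toContinuousLinearMap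

variable {E}

theorem twoFormToBilinL_apply (a : E [⋀^Fin 2]→L[ℝ] ℝ) (u v : E) :
    twoFormToBilinL E a u v = a ![u, v] :=
  congrArg a (by ext i; fin_cases i <;> rfl)

theorem twoFormToBilinL_skew (a : E [⋀^Fin 2]→L[ℝ] ℝ) (u v : E) :
    twoFormToBilinL E a u v = -twoFormToBilinL E a v u := by
  have hswap := a.toAlternatingMap.map_swap ![v, u] (show (0 : Fin 2) ≠ 1 by decide)
  have hvec : ![v, u] ∘ Equiv.swap 0 1 = ![u, v] := by ext i; fin_cases i <;> rfl
  rw [hvec] at hswap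
  simpa only [twoFormToBilinL_apply] using! hswap

theorem isClosedFormAt_twoFormToBilinL {ν : E → E [⋀^Fin 2]→L[ℝ] ℝ} {y : E}
    (hν : DifferentiableAt ℝ ν y) (hclosed : extDeriv ν y = 0) :
    IsClosedFormAt (fun z ↦ twoFormToBilinL E (ν z)) y := by
  intro u v w
  have hfderiv : fderiv ℝ (fun z ↦ twoFormToBilinL E (ν z)) y =
      twoFormToBilinL E ∘L fderiv ℝ ν y :=
    ((twoFormToBilinL E).hasFDerivAt.comp y hν.hasFDerivAt).fderiv
  have hcyclic := extDeriv_apply hν ![u, v, w]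
  have hremove0 : (0 : Fin 3).removeNth ![u, v, w] = ![v, w] := by ext i; fin_cases i <;> rfl
  have hremove1 : (1 : Fin 3).removeNth ![u, v, w] = ![u, w] := by ext i; fin_cases i <;> rfl
  have hremove2 : (2 : Fin 3).removeNth ![u, v, w] = ![u, v] := by ext i; fin_cases i <;> rfl
  rw [hclosed, Fin.sum_univ_three, hremove0, hremove1, hremove2] at hcyclic
  simp only [hfderiv, ContinuousLinearMap.comp_apply, twoFormToBilinL_apply]
  simpa [sub_eq_add_neg, fderiv_continuousAlternatingMap_apply_const_apply hν] using hcyclic.symm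

end TwoFormToBilin

/-! ### Linear normal form of a pair of transverse Lagrangian subspaces -/

section StandardForms

variable {n : ℕ}

/-- The real part of a coordinate of `ℂⁿ`, as a continuous linear form. -/
def reCoord (j : Fin n) : CSpace n →L[ℝ] ℝ :=
  Complex.reCLM ∘L (EuclideanSpace.proj j : CSpace n →L[ℂ] ℂ).restrictScalars ℝ

/-- The imaginary part of a coordinate of `ℂⁿ`, as a continuous linear form. -/
def imCoord (j : Fin n) : CSpace n →L[ℝ] ℝ :=
  Complex.imCLM ∘L (EuclideanSpace.proj j : CSpace n →L[ℂ] ℂ).restrictScalars ℝ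

@[simp]
theorem reCoord_apply (j : Fin n) (z : CSpace n) : reCoord j z = (z j).re := rfl

@[simp]
theorem imCoord_apply (j : Fin n) (z : CSpace n) : imCoord j z = (z j).im := rfl

/-- The standard symplectic form of `ℂⁿ`, as a continuous bilinear form. -/
def stdSymplecticForm (n : ℕ) : CSpace n →L[ℝ] CSpace n →L[ℝ] ℝ :=
  ∑ j, ((reCoord j).smulRight (imCoord j) - (imCoord j).smulRight (reCoord j))

theorem stdSymplecticForm_apply (u v : CSpace n) :
    stdSymplecticForm n u v = stdSymplectic u v := by
  simp [stdSymplecticForm, stdSymplectic]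

end StandardForms

section LinearNormalForm

theorem isInvertible_of_nondegenerate {V : Type*} [NormedAddCommGroup V] [NormedSpace ℝ V]
    [FiniteDimensional ℝ V] {B : V →L[ℝ] V →L[ℝ] ℝ} (hB : ∀ u, (∀ v, B u v = 0) → u = 0) :
    B.IsInvertible := by
  have hinj : Function.Injective (B : V →ₗ[ℝ] V →L[ℝ] ℝ) :=
    (injective_iff_map_eq_zero _).2 fun u hu ↦ hB u (DFunLike.congr_fun hu)
  have hrank : Module.finrank ℝ V = Module.finrank ℝ (V →L[ℝ] ℝ) := by
    rw [← (LinearMap.toContinuousLinearMap : (V →ₗ[ℝ] ℝ) ≃ₗ[ℝ] (V →L[ℝ] ℝ)).finrank_eq]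
    exact (Subspace.dual_finrank_eq (K := ℝ) (V := V)).symm
  exact ⟨(LinearEquiv.ofInjectiveOfFinrankEq _ hinj hrank).toContinuousLinearEquiv, by ext; rfl⟩

theorem exists_equiv_pairing_eq_inner {G : Type*} [NormedAddCommGroup G] [InnerProductSpace ℝ G]
    [FiniteDimensional ℝ G] {B : (G × G) →L[ℝ] (G × G) →L[ℝ] ℝ}
    (hB : ∀ u, (∀ v, B u v = 0) → u = 0) (hfst : ∀ a a', B (a, 0) (a', 0) = 0) :
    ∃ T : G ≃L[ℝ] G, ∀ a b, B (T a, 0) (0, b) = inner ℝ a b := by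
  let pairing : G →L[ℝ] G →L[ℝ] ℝ :=
    B.bilinearComp (ContinuousLinearMap.inl ℝ G G) (ContinuousLinearMap.inr ℝ G G)
  have hpairing : ∀ a, (∀ b, pairing a b = 0) → a = 0 := fun a ha ↦
    congrArg Prod.fst (hB (a, 0) fun v ↦ by
      rw [← Prod.fst_add_snd v, map_add, hfst, zero_add]
      exact ha v.2)
  obtain ⟨P, hP⟩ := isInvertible_of_nondegenerate hpairing
  obtain ⟨I, hI⟩ := isInvertible_of_nondegenerate (B := innerSL ℝ (E := G)) fun a ha ↦
    inner_self_eq_zero.1 (ha a)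
  refine ⟨I.trans P.symm, fun a b ↦ ?_⟩
  change pairing (P.symm (I a)) b = inner ℝ a b
  rw [← hP, ← innerSL_apply_apply ℝ a b, ← hI]
  simp

/-- The decomposition of a vector of `ℂⁿ` into its real and imaginary parts. -/
def reImEquiv (n : ℕ) : CSpace n ≃ₗ[ℝ] EuclideanSpace ℝ (Fin n) × EuclideanSpace ℝ (Fin n) where
  toFun z := (WithLp.toLp 2 fun j ↦ (z j).re, WithLp.toLp 2 fun j ↦ (z j).im)
  invFun p := WithLp.toLp 2 fun j ↦ ⟨p.1 j, p.2 j⟩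
  map_add' _ _ := by ext <;> simp
  map_smul' _ _ := by ext <;> simp
  left_inv _ := by ext; simp
  right_inv _ := by ext <;> simp

variable {n : ℕ}

local notation "ℝN" => EuclideanSpace ℝ (Fin n)

theorem reImEquiv_fst_eq_zero_iff {z : CSpace n} : (reImEquiv n z).1 = 0 ↔ z ∈ imagPlane n :=
  PiLp.ext_iff

theorem reImEquiv_snd_eq_zero_iff {z : CSpace n} : (reImEquiv n z).2 = 0 ↔ z ∈ realPlane n :=
  PiLp.ext_iff

theorem stdSymplecticForm_eq_inner (z w : CSpace n) :
    stdSymplecticForm n z w = inner ℝ (reImEquiv n z).1 (reImEquiv n w).2 -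
      inner ℝ (reImEquiv n w).1 (reImEquiv n z).2 := by
  simp [stdSymplecticForm_apply, stdSymplectic, reImEquiv, PiLp.inner_apply, mul_comm]

theorem exists_linear_symplectic_equiv {B : (ℝN × ℝN) →L[ℝ] (ℝN × ℝN) →L[ℝ] ℝ}
    (hskew : ∀ u v, B u v = -B v u) (hB : ∀ u, (∀ v, B u v = 0) → u = 0)
    (hfst : ∀ a a', B (a, 0) (a', 0) = 0) (hsnd : ∀ b b', B (0, b) (0, b') = 0) :
    ∃ Λ : CSpace n ≃L[ℝ] ℝN × ℝN, (∀ z w, B (Λ z) (Λ w) = stdSymplecticForm n z w) ∧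
      (∀ z, (Λ z).1 = 0 ↔ z ∈ imagPlane n) ∧ (∀ z, (Λ z).2 = 0 ↔ z ∈ realPlane n) := by
  obtain ⟨T, hT⟩ := exists_equiv_pairing_eq_inner hB hfst
  have hpair : ∀ p q : ℝN × ℝN,
      B (T p.1, p.2) (T q.1, q.2) = inner ℝ p.1 q.2 - inner ℝ q.1 p.2 := fun ⟨a, b⟩ ⟨a', b'⟩ ↦ by
    have hsplit : ∀ c d, ((T c, d) : ℝN × ℝN) = (T c, 0) + (0, d) := fun c d ↦ by simp
    rw [hsplit a b, hsplit a' b']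
    simp only [map_add, _root_.add_apply, hfst, hsnd, hskew (0, b), hT]
    ring
  exact ⟨(reImEquiv n).toContinuousLinearEquiv.trans (T.prodCongr (.refl ℝ ℝN)),
    fun z w ↦ (hpair _ _).trans (stdSymplecticForm_eq_inner z w).symm,
    fun z ↦ T.map_eq_zero_iff.trans reImEquiv_fst_eq_zero_iff,
    fun z ↦ reImEquiv_snd_eq_zero_iff⟩

end LinearNormalForm

/-! ### Partial diffeomorphisms -/

section PartialDiffeomorphisms

variable (E F : Type*) [NormedAddCommGroup E] [NormedSpace ℝ E] [NormedAddCommGroup F]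
  [NormedSpace ℝ F] {G : Type*} [NormedAddCommGroup G] [NormedSpace ℝ G]
  {X Y Z : Type*} [TopologicalSpace X] [ChartedSpace E X] [TopologicalSpace Y] [ChartedSpace F Y]
  [TopologicalSpace Z] [ChartedSpace G Z]

/-- The differential of `f` at `x`, typed as a linear map between the model spaces instead of the
tangent spaces `TangentSpace`, which have the same underlying vector spaces. -/
abbrev differential (f : X → Y) (x : X) : E →L[ℝ] F :=
  mfderiv 𝓘(ℝ, E) 𝓘(ℝ, F) f x

/-- The partial homeomorphism `φ` is a diffeomorphism from its source onto its target. -/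
structure IsPartialDiffeo (φ : OpenPartialHomeomorph X Y) : Prop where
  smooth : ContMDiffOn 𝓘(ℝ, E) 𝓘(ℝ, F) ∞ φ φ.source
  smooth_symm : ContMDiffOn 𝓘(ℝ, F) 𝓘(ℝ, E) ∞ φ.symm φ.target

variable {E F}

theorem differential_comp {g : Y → Z} {f : X → Y} {x : X}
    (hg : MDifferentiableAt 𝓘(ℝ, F) 𝓘(ℝ, G) g (f x))
    (hf : MDifferentiableAt 𝓘(ℝ, E) 𝓘(ℝ, F) f x) :
    differential E G (g ∘ f) x = differential F G g (f x) ∘L differential E F f x :=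
  mfderiv_comp x hg hf

theorem isPartialDiffeo_of_contDiffOn {e : OpenPartialHomeomorph E F}
    (he : ContDiffOn ℝ ∞ e e.source) (he' : ContDiffOn ℝ ∞ e.symm e.target) :
    IsPartialDiffeo E F e :=
  ⟨contMDiffOn_iff_contDiffOn.2 he, contMDiffOn_iff_contDiffOn.2 he'⟩

theorem isPartialDiffeo_continuousLinearEquiv (Λ : E ≃L[ℝ] F) :
    IsPartialDiffeo E F Λ.toHomeomorph.toOpenPartialHomeomorph :=
  isPartialDiffeo_of_contDiffOn Λ.contDiff.contDiffOn Λ.symm.contDiff.contDiffOn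

theorem isPartialDiffeo_of_mem_maximalAtlas {c : OpenPartialHomeomorph X E}
    (hc : c ∈ IsManifold.maximalAtlas 𝓘(ℝ, E) ∞ X) : IsPartialDiffeo E E c :=
  ⟨contMDiffOn_of_mem_maximalAtlas hc, contMDiffOn_symm_of_mem_maximalAtlas hc⟩

theorem isPartialDiffeo_chartAt [IsManifold 𝓘(ℝ, E) ∞ X] (x : X) :
    IsPartialDiffeo E E (chartAt E x) :=
  isPartialDiffeo_of_mem_maximalAtlas (IsManifold.chart_mem_maximalAtlas x)

namespace IsPartialDiffeo

variable {φ : OpenPartialHomeomorph X Y}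

theorem symm (hφ : IsPartialDiffeo E F φ) : IsPartialDiffeo F E φ.symm :=
  ⟨hφ.smooth_symm, hφ.smooth⟩

theorem trans {ψ : OpenPartialHomeomorph Y Z} (hφ : IsPartialDiffeo E F φ)
    (hψ : IsPartialDiffeo F G ψ) : IsPartialDiffeo E G (φ ≫ₕ ψ) where
  smooth := hψ.smooth.comp (hφ.smooth.mono inter_subset_left) inter_subset_right
  smooth_symm := hφ.smooth_symm.comp (hψ.smooth_symm.mono inter_subset_left) inter_subset_right

theorem mdifferentiable (hφ : IsPartialDiffeo E F φ) : φ.MDifferentiable 𝓘(ℝ, E) 𝓘(ℝ, F) :=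
  ⟨hφ.smooth.mdifferentiableOn (by simp), hφ.smooth_symm.mdifferentiableOn (by simp)⟩

theorem mdifferentiableAt (hφ : IsPartialDiffeo E F φ) {x : X} (hx : x ∈ φ.source) :
    MDifferentiableAt 𝓘(ℝ, E) 𝓘(ℝ, F) φ x :=
  hφ.mdifferentiable.mdifferentiableAt hx

theorem differential_symm_differential (hφ : IsPartialDiffeo E F φ) {x : X} (hx : x ∈ φ.source)
    (u : E) : differential F E φ.symm (φ x) (differential E F φ x u) = u :=
  congrArg (fun T : E →L[ℝ] E ↦ T u) (hφ.mdifferentiable.symm_comp_deriv hx)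

theorem differential_differential_symm (hφ : IsPartialDiffeo E F φ) {x : X} (hx : x ∈ φ.source)
    (v : F) : differential E F φ x (differential F E φ.symm (φ x) v) = v := by
  have h := hφ.symm.differential_symm_differential (φ.map_source hx) v
  rwa [OpenPartialHomeomorph.symm_symm, φ.left_inv hx] at h

theorem differential_injective (hφ : IsPartialDiffeo E F φ) {x : X} (hx : x ∈ φ.source) :
    Function.Injective (differential E F φ x) :=
  Function.LeftInverse.injective (hφ.differential_symm_differential hx)

theorem differential_surjective (hφ : IsPartialDiffeo E F φ) {x : X} (hx : x ∈ φ.source) :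
    Function.Surjective (differential E F φ x) :=
  Function.RightInverse.surjective (hφ.differential_differential_symm hx)

theorem hasFDerivAt_comp_symm {φ : OpenPartialHomeomorph X F} (hφ : IsPartialDiffeo E F φ)
    {H : X → G} {x : X} (hx : x ∈ φ.source) (hH : MDifferentiableAt 𝓘(ℝ, E) 𝓘(ℝ, G) H x) :
    HasFDerivAt (H ∘ φ.symm) (differential E G H x ∘L differential F E φ.symm (φ x)) (φ x) := by
  have hH' : HasMFDerivAt 𝓘(ℝ, E) 𝓘(ℝ, G) H (φ.symm (φ x)) (differential E G H x) := by
    rw [φ.left_inv hx]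
    exact hH.hasMFDerivAt
  exact hasMFDerivAt_iff_hasFDerivAt.1
    (hH'.comp _ (hφ.symm.mdifferentiableAt (φ.map_source hx)).hasMFDerivAt)

end IsPartialDiffeo

theorem differential_apply_of_comp_eq {H : X → G} {ψ : F → X} {s : Set F} (hs : IsOpen s)
    {y : F} (hy : y ∈ s) (hH : MDifferentiableAt 𝓘(ℝ, E) 𝓘(ℝ, G) H (ψ y))
    (hψ : MDifferentiableAt 𝓘(ℝ, F) 𝓘(ℝ, E) ψ y) {T : F →L[ℝ] G} (hT : ∀ z ∈ s, H (ψ z) = T z)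
    (u : F) : differential E G H (ψ y) (differential F E ψ y u) = T u := by
  have hcomp := (hH.hasMFDerivAt.comp y hψ.hasMFDerivAt).congr_of_eventuallyEq (f₁ := T)
    (by filter_upwards [hs.mem_nhds hy] with z hz using (hT z hz).symm)
  exact congrArg (fun S : F →L[ℝ] G ↦ S u)
    (hasMFDerivAt_unique hcomp (T.hasFDerivAt.hasMFDerivAt (x := y)))

theorem exists_isPartialDiffeo_rightInverse [FiniteDimensional ℝ E] [FiniteDimensional ℝ G]
    [IsManifold 𝓘(ℝ, E) ∞ X] {N : Set X} (hN : IsOpen N) {H : X → G}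
    (hH : ContMDiffOn 𝓘(ℝ, E) 𝓘(ℝ, G) ∞ H N) {x : X} (hx : x ∈ N)
    (hinj : Function.Injective (differential E G H x))
    (hdim : Module.finrank ℝ E = Module.finrank ℝ G) :
    ∃ ψ : OpenPartialHomeomorph G X, IsPartialDiffeo G E ψ ∧ x ∈ ψ.target ∧ ψ.target ⊆ N ∧
      ∀ y ∈ ψ.source, H (ψ y) = y := by
  let κ := chartAt E x
  have hκ : IsPartialDiffeo E E κ := isPartialDiffeo_chartAt x
  have hxκ : x ∈ κ.source := mem_chart_source E x
  let T : Set E := κ.target ∩ κ.symm ⁻¹' N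
  have hT : IsOpen T := κ.isOpen_inter_preimage_symm hN
  have hκx : κ.symm (κ x) = x := κ.left_inv hxκ
  have haT : κ x ∈ T := ⟨κ.map_source hxκ, by rwa [mem_preimage, hκx]⟩
  have hf : ContDiffOn ℝ ∞ (H ∘ κ.symm) T :=
    contMDiffOn_iff_contDiffOn.1 <|
      hH.comp (hκ.smooth_symm.mono inter_subset_left) inter_subset_right
  have hf' := hκ.hasFDerivAt_comp_symm hxκ
    (((hH x hx).contMDiffAt (hN.mem_nhds hx)).mdifferentiableAt (by simp))
  have hf'inj : Function.Injective (differential E G H x ∘L differential E E κ.symm (κ x)) :=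
    hinj.comp (hκ.symm.differential_injective (κ.map_source hxκ))
  let D : E ≃L[ℝ] G :=
    (LinearEquiv.ofInjectiveOfFinrankEq _ hf'inj hdim).toContinuousLinearEquiv
  obtain ⟨e, heH, hxe, heT, -, hesymm⟩ :=
    exists_openPartialHomeomorph_of_contDiffOn hT hf haT D hf'
  have he : IsPartialDiffeo E G e :=
    isPartialDiffeo_of_contDiffOn (heH ▸ hf.mono heT) hesymm
  refine ⟨e.symm ≫ₕ κ.symm, he.symm.trans hκ.symm, ⟨hxκ, hxe⟩, ?_, fun y hy ↦ ?_⟩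
  · intro z hz
    rw [← κ.left_inv hz.1]
    exact (heT hz.2).2
  · exact (congrFun heH _).symm.trans (e.right_inv hy.1)

end PartialDiffeomorphisms

/-! ### Local equations of submanifolds -/

section LocalEquations

variable {n : ℕ} {E : Type*} [NormedAddCommGroup E] [NormedSpace ℝ E]
  {G : Type*} [NormedAddCommGroup G] [NormedSpace ℝ G]
  {X : Type*} [TopologicalSpace X] [ChartedSpace E X]
  {L : Type*} [TopologicalSpace L] [ChartedSpace (EuclideanSpace ℝ (Fin n)) L] {ι : L → X}

local notation "ℝN" => EuclideanSpace ℝ (Fin n)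

variable (n E) in
/-- `F = 0` is a regular equation, in the open set `N`, of the submanifold parametrized by `ι`. -/
structure IsLocalEquation (ι : L → X) (N : Set X) (F : X → G) : Prop where
  isOpen : IsOpen N
  smooth : ContMDiffOn 𝓘(ℝ, E) 𝓘(ℝ, G) ∞ F N
  mem_range_iff : ∀ y ∈ N, y ∈ range ι ↔ F y = 0
  ker_le : ∀ q, ι q ∈ N → (differential E G F (ι q)).ker ≤ tangentImage n E ι q

theorem IsLocalEquation.mdifferentiableAt {N : Set X} {F : X → G}
    (hF : IsLocalEquation n E ι N F) {x : X} (hx : x ∈ N) :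
    MDifferentiableAt 𝓘(ℝ, E) 𝓘(ℝ, G) F x :=
  ((hF.smooth x hx).contMDiffAt (hF.isOpen.mem_nhds hx)).mdifferentiableAt (by simp)

theorem ker_differential_snd_le_tangentImage {d : OpenPartialHomeomorph L ℝN}
    {c : OpenPartialHomeomorph X (ℝN × G)} (hd : IsPartialDiffeo ℝN ℝN d)
    (hc : IsPartialDiffeo E (ℝN × G) c)
    (hslice : ∀ q ∈ d.source, ι q ∈ c.source ∧ c (ι q) = (d q, 0)) {q : L} (hq : q ∈ d.source)
    (hι : MDifferentiableAt (𝓡 n) 𝓘(ℝ, E) ι q) :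
    (differential E G (fun y ↦ (c y).2) (ι q)).ker ≤ tangentImage n E ι q := by
  intro w hw
  have hcq := hc.mdifferentiableAt (hslice q hq).1
  have hDF : differential E G (fun y ↦ (c y).2) (ι q) =
      ContinuousLinearMap.snd ℝ ℝN G ∘L differential E (ℝN × G) c (ι q) :=
    (hasFDerivAt_snd.hasMFDerivAt.comp (ι q) hcq.hasMFDerivAt).mfderiv
  have hDι : differential E (ℝN × G) c (ι q) ∘L differential ℝN E ι q =
      ContinuousLinearMap.inl ℝ ℝN G ∘L differential ℝN ℝN d q := by
    refine hasMFDerivAt_unique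
      ((hcq.hasMFDerivAt.comp q hι.hasMFDerivAt).congr_of_eventuallyEq ?_)
      ((ContinuousLinearMap.inl ℝ ℝN G).hasFDerivAt.hasMFDerivAt.comp q
        (hd.mdifferentiableAt hq).hasMFDerivAt)
    filter_upwards [d.open_source.mem_nhds hq] with r hr using (hslice r hr).2.symm
  obtain ⟨a, ha⟩ := hd.differential_surjective hq (differential E (ℝN × G) c (ι q) w).1
  refine ⟨a, hc.differential_injective (hslice q hq).1 ?_⟩
  calc differential E (ℝN × G) c (ι q) (differential ℝN E ι q a)
      = (differential ℝN ℝN d q a, 0) := congrArg (fun T : ℝN →L[ℝ] ℝN × G ↦ T a) hDι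
    _ = differential E (ℝN × G) c (ι q) w :=
      Prod.ext ha (hw.symm.trans (congrArg (fun T : E →L[ℝ] G ↦ T w) hDF))

variable [FiniteDimensional ℝ E] [FiniteDimensional ℝ G]

theorem exists_slice_chart {p : L} (hι : Manifold.IsImmersionAt (𝓡 n) 𝓘(ℝ, E) ∞ ι p)
    (hdim : Module.finrank ℝ E = n + Module.finrank ℝ G) :
    ∃ (d : OpenPartialHomeomorph L ℝN) (c : OpenPartialHomeomorph X (ℝN × G)),
      IsPartialDiffeo ℝN ℝN d ∧ IsPartialDiffeo E (ℝN × G) c ∧ p ∈ d.source ∧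
      ∀ q ∈ d.source, ι q ∈ c.source ∧ c (ι q) = (d q, 0) := by
  have : FiniteDimensional ℝ (ℝN × hι.complement) := hι.equiv.symm.finiteDimensional
  have : FiniteDimensional ℝ hι.complement :=
    Module.Finite.of_surjective (LinearMap.snd ℝ ℝN hι.complement) LinearMap.snd_surjective
  have hcomplement : Module.finrank ℝ hι.complement = Module.finrank ℝ G := by
    have hsum := hι.equiv.toLinearEquiv.finrank_eq
    rw [Module.finrank_prod, finrank_euclideanSpace_fin] at hsum
    omega
  have hιG : Manifold.IsImmersionAtOfComplement G (𝓡 n) 𝓘(ℝ, E) ∞ ι p :=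
    hι.isImmersionAtOfComplement_complement.trans_F (.ofFinrankEq hcomplement)
  refine ⟨hιG.domChart, hιG.codChart ≫ₕ hιG.equiv.symm.toHomeomorph.toOpenPartialHomeomorph,
    isPartialDiffeo_of_mem_maximalAtlas hιG.domChart_mem_maximalAtlas,
    (isPartialDiffeo_of_mem_maximalAtlas hιG.codChart_mem_maximalAtlas).trans
      (isPartialDiffeo_continuousLinearEquiv _), hιG.mem_domChart_source, fun q hq ↦
    ⟨⟨hιG.source_subset_preimage_source hq, mem_univ _⟩, ?_⟩⟩
  have hmem : hιG.domChart q ∈ (hιG.domChart.extend (𝓡 n)).target := by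
    simpa using hιG.domChart.map_source hq
  have hwritten := hιG.writtenInCharts hmem
  refine hιG.equiv.symm_apply_eq.2 ?_
  simpa [hιG.domChart.left_inv hq] using hwritten

theorem exists_isLocalEquation (hι : Manifold.IsSmoothEmbedding (𝓡 n) 𝓘(ℝ, E) ∞ ι)
    (hdim : Module.finrank ℝ E = n + Module.finrank ℝ G) (p : L) :
    ∃ (N : Set X) (F : X → G), ι p ∈ N ∧ IsLocalEquation n E ι N F := by
  obtain ⟨d, c, hd, hc, hp, hslice⟩ :=
    exists_slice_chart (hι.isImmersion.isImmersionAt p) hdim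
  obtain ⟨V, hV, hVd⟩ := hι.isEmbedding.isOpen_iff.1 d.open_source
  have hmemV : ∀ q, ι q ∈ V ↔ q ∈ d.source := fun q ↦ by rw [← hVd, mem_preimage]
  refine ⟨V ∩ (c.source ∩ c ⁻¹' (d.target ×ˢ univ)), fun y ↦ (c y).2, ?_, ?_⟩
  · refine ⟨(hmemV p).2 hp, (hslice p hp).1, ?_⟩
    rw [mem_preimage, (hslice p hp).2]
    exact ⟨d.map_source hp, mem_univ _⟩
  refine ⟨hV.inter (c.isOpen_inter_preimage (d.open_target.prod isOpen_univ)), ?_, ?_, ?_⟩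
  · exact contDiff_snd.contMDiff.comp_contMDiffOn (hc.smooth.mono fun y hy ↦ hy.2.1)
  · rintro y ⟨hyV, hyc, hyd⟩
    constructor
    · rintro ⟨q, rfl⟩
      rw [(hslice q ((hmemV q).1 hyV)).2]
    · intro hy
      have hq := d.map_target hyd.1
      refine ⟨d.symm (c y).1, c.injOn (hslice _ hq).1 hyc ?_⟩
      rw [(hslice _ hq).2, d.right_inv hyd.1, ← hy]
  · intro q hq
    have hqd := (hmemV q).1 hq.1
    exact ker_differential_snd_le_tangentImage hd hc hslice hqd
      ((hι.contMDiff q).mdifferentiableAt (by simp))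

end LocalEquations

/-! ### Pullbacks of symplectic forms -/

section Pullback

variable {E F : Type*} [NormedAddCommGroup E] [NormedSpace ℝ E] [NormedAddCommGroup F]
  [NormedSpace ℝ F] {X : Type*} [TopologicalSpace X] [ChartedSpace E X]

/-- The bilinear form on `E` underlying a symplectic form at a point. -/
def SymplecticForm.bilin (σ : SymplecticForm E X) (x : X) : E →L[ℝ] E →L[ℝ] ℝ :=
  twoFormToBilinL E (σ.toForm x)

theorem SymplecticForm.bilin_apply (σ : SymplecticForm E X) (x : X) (u v : E) :
    σ.bilin x u v = σ.toForm x ![u, v] :=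
  twoFormToBilinL_apply (E := E) (σ.toForm x) u v

theorem SymplecticForm.bilin_skew (σ : SymplecticForm E X) (x : X) (u v : E) :
    σ.bilin x u v = -σ.bilin x v u :=
  twoFormToBilinL_skew (E := E) (σ.toForm x) u v

theorem SymplecticForm.eq_zero_of_bilin_eq_zero (σ : SymplecticForm E X) (x : X) {u : E}
    (hu : ∀ v, σ.bilin x u v = 0) : u = 0 :=
  σ.nondegenerate x u fun v ↦ (σ.bilin_apply x u v).symm.trans (hu v)

/-- The pullback of a symplectic form along a map defined on a normed space, as a field of
bilinear forms. -/
def SymplecticForm.pullback (σ : SymplecticForm E X) (ψ : F → X) (y : F) : F →L[ℝ] F →L[ℝ] ℝ :=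
  (σ.bilin (ψ y)).bilinearComp (differential F E ψ y) (differential F E ψ y)

theorem SymplecticForm.pullback_apply (σ : SymplecticForm E X) (ψ : F → X) (y u v : F) :
    σ.pullback ψ y u v =
      σ.bilin (ψ y) (differential F E ψ y u) (differential F E ψ y v) := rfl

theorem SymplecticForm.pullback_skew (σ : SymplecticForm E X) (ψ : F → X) (y u v : F) :
    σ.pullback ψ y u v = -σ.pullback ψ y v u :=
  σ.bilin_skew _ _ _

theorem twoFormToBilinL_compContinuousLinearMap (a : E [⋀^Fin 2]→L[ℝ] ℝ) (T : F →L[ℝ] E) :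
    twoFormToBilinL F (a.compContinuousLinearMap T) =
      (twoFormToBilinL E a).bilinearComp T T := by
  ext u v
  simp only [twoFormToBilinL_apply, ContinuousLinearMap.bilinearComp_apply,
    ContinuousAlternatingMap.compContinuousLinearMap_apply]
  exact congrArg a (by ext i; fin_cases i <;> rfl)

theorem contDiffOn_bilinearComp {V : Type*} [NormedAddCommGroup V] [NormedSpace ℝ V]
    {s : Set V} {B : V → E →L[ℝ] E →L[ℝ] ℝ} {S T : V → F →L[ℝ] E} (hB : ContDiffOn ℝ ∞ B s)
    (hS : ContDiffOn ℝ ∞ S s) (hT : ContDiffOn ℝ ∞ T s) :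
    ContDiffOn ℝ ∞ (fun y ↦ (B y).bilinearComp (S y) (T y)) s :=
  (ContinuousLinearMap.flipₗᵢ ℝ F F ℝ).contDiff.comp_contDiffOn <|
    ((ContinuousLinearMap.flipₗᵢ ℝ F E ℝ).contDiff.comp_contDiffOn (hB.clm_comp hS)).clm_comp hT

variable [IsManifold 𝓘(ℝ, E) ∞ X] (σ : SymplecticForm E X) {ψ : F → X} {s : Set F}

theorem SymplecticForm.pullback_eq_inChart {y : F}
    (hψ : MDifferentiableAt 𝓘(ℝ, F) 𝓘(ℝ, E) ψ y) {x₀ : X} (hy : ψ y ∈ (chartAt E x₀).source) :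
    σ.pullback ψ y = twoFormToBilinL F
      ((σ.toForm.inChart (chartAt E x₀) (chartAt E x₀ (ψ y))).compContinuousLinearMap
        (fderiv ℝ (chartAt E x₀ ∘ ψ) y)) := by
  have hκ : IsPartialDiffeo E E (chartAt E x₀) := isPartialDiffeo_chartAt x₀
  have hderiv : fderiv ℝ (chartAt E x₀ ∘ ψ) y =
      differential E E (chartAt E x₀) (ψ y) ∘L differential F E ψ y :=
    mfderiv_eq_fderiv.symm.trans (differential_comp (hκ.mdifferentiableAt hy) hψ)
  have hinChart : twoFormToBilinL E
      (σ.toForm.inChart (chartAt E x₀) (chartAt E x₀ (ψ y))) =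
        (σ.bilin ((chartAt E x₀).symm (chartAt E x₀ (ψ y)))).bilinearComp
          (differential E E (chartAt E x₀).symm (chartAt E x₀ (ψ y)))
          (differential E E (chartAt E x₀).symm (chartAt E x₀ (ψ y))) :=
    twoFormToBilinL_compContinuousLinearMap (E := E) _ _
  rw [twoFormToBilinL_compContinuousLinearMap, hinChart, (chartAt E x₀).left_inv hy, hderiv]
  ext u v
  simp only [pullback_apply, ContinuousLinearMap.bilinearComp_apply,
    ContinuousLinearMap.comp_apply, hκ.differential_symm_differential hy]

theorem contDiffOn_chart_comp (hψ : ContMDiffOn 𝓘(ℝ, F) 𝓘(ℝ, E) ∞ ψ s) (x₀ : X) :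
    ContDiffOn ℝ ∞ (chartAt E x₀ ∘ ψ) (s ∩ ψ ⁻¹' (chartAt E x₀).source) :=
  contMDiffOn_iff_contDiffOn.1 <|
    (isPartialDiffeo_chartAt x₀).smooth.comp (hψ.mono inter_subset_left) inter_subset_right

theorem SymplecticForm.contDiffOn_pullback (hs : IsOpen s)
    (hψ : ContMDiffOn 𝓘(ℝ, F) 𝓘(ℝ, E) ∞ ψ s) : ContDiffOn ℝ ∞ (σ.pullback ψ) s := by
  intro y hy
  let κ := chartAt E (ψ y)
  let t := s ∩ ψ ⁻¹' κ.source
  have ht : IsOpen t := hψ.continuousOn.isOpen_inter_preimage hs κ.open_source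
  have hk : ContDiffOn ℝ ∞ (κ ∘ ψ) t := contDiffOn_chart_comp hψ (ψ y)
  have hform : ContDiffOn ℝ ∞ (fun z ↦ twoFormToBilinL E (σ.toForm.inChart κ (κ (ψ z)))) t :=
    (twoFormToBilinL E).contDiff.comp_contDiffOn <|
      (σ.smooth κ (chart_mem_atlas E _)).comp hk fun z hz ↦ κ.map_source hz.2
  have hDk := hk.fderiv_of_isOpen (m := ∞) ht (by simp)
  have heq : EqOn (σ.pullback ψ) (fun z ↦ (twoFormToBilinL E
      (σ.toForm.inChart κ (κ (ψ z)))).bilinearComp (fderiv ℝ (κ ∘ ψ) z) (fderiv ℝ (κ ∘ ψ) z))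
      t := fun z hz ↦ by
    rw [σ.pullback_eq_inChart (((hψ z hz.1).contMDiffAt (hs.mem_nhds hz.1)).mdifferentiableAt
      (by simp)) hz.2, twoFormToBilinL_compContinuousLinearMap]
  have hyt : t ∈ 𝓝 y := ht.mem_nhds ⟨hy, mem_chart_source E _⟩
  exact (((contDiffOn_bilinearComp hform hDk hDk).congr heq).contDiffAt hyt).contDiffWithinAt

theorem SymplecticForm.isClosedFormAt_pullback (hs : IsOpen s)
    (hψ : ContMDiffOn 𝓘(ℝ, F) 𝓘(ℝ, E) ∞ ψ s) {y : F} (hy : y ∈ s) :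
    IsClosedFormAt (σ.pullback ψ) y := by
  let κ := chartAt E (ψ y)
  let t := s ∩ ψ ⁻¹' κ.source
  have ht : IsOpen t := hψ.continuousOn.isOpen_inter_preimage hs κ.open_source
  have hyt : t ∈ 𝓝 y := ht.mem_nhds ⟨hy, mem_chart_source E _⟩
  have hκy : κ (ψ y) ∈ κ.target := κ.map_source (mem_chart_source E _)
  have hk : ContDiffAt ℝ ∞ (κ ∘ ψ) y := (contDiffOn_chart_comp hψ (ψ y)).contDiffAt hyt
  have hform : DifferentiableAt ℝ (σ.toForm.inChart κ) (κ (ψ y)) :=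
    ((σ.smooth κ (chart_mem_atlas E _)).contDiffAt
      (κ.open_target.mem_nhds hκy)).differentiableAt (by simp)
  have heq : σ.pullback ψ =ᶠ[𝓝 y] fun z ↦ twoFormToBilinL F
      ((σ.toForm.inChart κ (κ (ψ z))).compContinuousLinearMap (fderiv ℝ (κ ∘ ψ) z)) := by
    filter_upwards [hyt] with z hz using σ.pullback_eq_inChart
      (((hψ z hz.1).contMDiffAt (hs.mem_nhds hz.1)).mdifferentiableAt (by simp)) hz.2
  have hclosed : extDeriv (fun z ↦ (σ.toForm.inChart κ ((κ ∘ ψ) z)).compContinuousLinearMap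
      (fderiv ℝ (κ ∘ ψ) z)) y = 0 := by
    rw [extDeriv_pullback (r := 2) (f := κ ∘ ψ) hform (hk.of_le (by norm_cast)) (by simp),
      Function.comp_apply, σ.closed κ (chart_mem_atlas E _) _ hκy]
    rfl
  have hdiff : DifferentiableAt ℝ (fun z ↦
      (σ.toForm.inChart κ ((κ ∘ ψ) z)).compContinuousLinearMap (fderiv ℝ (κ ∘ ψ) z)) y :=
    (hform.comp y (hk.differentiableAt (by simp))).continuousAlternatingMapCompContinuousLinearMap
      ((hk.fderiv_right (m := ∞) (by simp)).differentiableAt (by simp))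
  intro u v w
  rw [heq.fderiv_eq]
  exact isClosedFormAt_twoFormToBilinL hdiff hclosed u v w

end Pullback

/-! ### Darboux charts adapted to two transverse Lagrangians -/

section PullbackComposition

variable {n : ℕ} {E F G : Type*} [NormedAddCommGroup E] [NormedSpace ℝ E]
  [NormedAddCommGroup F] [NormedSpace ℝ F] [NormedAddCommGroup G] [NormedSpace ℝ G]
  {X : Type*} [TopologicalSpace X] [ChartedSpace E X] (σ : SymplecticForm E X)

theorem SymplecticForm.eq_zero_of_pullback_eq_zero {ψ : OpenPartialHomeomorph F X}
    (hψ : IsPartialDiffeo F E ψ) {y : F} (hy : y ∈ ψ.source) {u : F}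
    (hu : ∀ v, σ.pullback ψ y u v = 0) : u = 0 := by
  refine (injective_iff_map_eq_zero _).1 (hψ.differential_injective hy) u
    (σ.eq_zero_of_bilin_eq_zero (ψ y) fun w ↦ ?_)
  obtain ⟨v, rfl⟩ := hψ.differential_surjective hy w
  exact hu v

theorem SymplecticForm.pullback_comp {ψ : F → X} {f : G → F} {z : G}
    (hψ : MDifferentiableAt 𝓘(ℝ, F) 𝓘(ℝ, E) ψ (f z)) (hf : DifferentiableAt ℝ f z) (u v : G) :
    σ.pullback (ψ ∘ f) z u v = σ.pullback ψ (f z) (fderiv ℝ f z u) (fderiv ℝ f z v) := by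
  have hcomp : differential G E (ψ ∘ f) z = differential F E ψ (f z) ∘L fderiv ℝ f z :=
    (differential_comp hψ hf.mdifferentiableAt).trans
      (congrArg (differential F E ψ (f z) ∘L ·) mfderiv_eq_fderiv)
  rw [σ.pullback_apply, hcomp]
  rfl

end PullbackComposition

section AdaptedDarbouxCharts

theorem inf_eq_bot_of_sup_eq_top_of_finrank_le {V : Type*} [AddCommGroup V] [Module ℝ V]
    [FiniteDimensional ℝ V] {W₁ W₂ : Submodule ℝ V}
    (hdim : Module.finrank ℝ W₁ + Module.finrank ℝ W₂ ≤ Module.finrank ℝ V)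
    (hsup : W₁ ⊔ W₂ = ⊤) : W₁ ⊓ W₂ = ⊥ := by
  have hsum := Submodule.finrank_sup_add_finrank_inf_eq W₁ W₂
  rw [hsup, finrank_top] at hsum
  exact Submodule.finrank_eq_zero.1 (by omega)

variable {n : ℕ} {E : Type*} [NormedAddCommGroup E] [NormedSpace ℝ E]
  {X : Type*} [TopologicalSpace X] [ChartedSpace E X] {σ : SymplecticForm E X}
  {L L' : Type*} [TopologicalSpace L] [ChartedSpace (EuclideanSpace ℝ (Fin n)) L]
  [TopologicalSpace L'] [ChartedSpace (EuclideanSpace ℝ (Fin n)) L'] {ι : L → X} {ι' : L' → X}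

local notation "ℝN" => EuclideanSpace ℝ (Fin n)

theorem finrank_tangentImage_le (ι : L → X) (p : L) :
    Module.finrank ℝ (tangentImage n E ι p) ≤ n :=
  (LinearMap.finrank_range_le (differential ℝN E ι p : ℝN →ₗ[ℝ] E)).trans_eq (by simp)

theorem IsLagrangianEmbedding.bilin_eq_zero (hι : IsLagrangianEmbedding n σ ι) {p : L} {u v : E}
    (hu : u ∈ tangentImage n E ι p) (hv : v ∈ tangentImage n E ι p) :
    σ.bilin (ι p) u v = 0 := by
  obtain ⟨a, rfl⟩ := hu
  obtain ⟨b, rfl⟩ := hv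
  exact (σ.bilin_apply _ _ _).trans (hι.isotropic p a b)

theorem IsLocalEquation.isLagrangianOn_pullback {F G : Type*} [NormedAddCommGroup F]
    [NormedSpace ℝ F] [FiniteDimensional ℝ F] [NormedAddCommGroup G] [NormedSpace ℝ G]
    {N : Set X} {f : X → G} (hf : IsLocalEquation n E ι N f) (hι : IsLagrangianEmbedding n σ ι)
    {ψ : OpenPartialHomeomorph F X} (hψ : IsPartialDiffeo F E ψ) (hψN : ψ.target ⊆ N)
    {T : F →L[ℝ] G} (hT : Function.Surjective T) (hfψ : ∀ y ∈ ψ.source, f (ψ y) = T y)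
    (hdim : Module.finrank ℝ F = 2 * Module.finrank ℝ G) :
    IsLagrangianOn (σ.pullback ψ) ψ.source T.ker where
  half_dim := by
    have hrank := LinearMap.finrank_range_add_finrank_ker (T : F →ₗ[ℝ] G)
    rw [LinearMap.range_eq_top.2 hT, finrank_top] at hrank
    omega
  isotropic y hyT hy u hu v hv := by
    have hψy : ψ y ∈ N := hψN (ψ.map_source hy)
    obtain ⟨q, hq⟩ := (hf.mem_range_iff _ hψy).2 ((hfψ y hy).trans hyT)
    have htangent : ∀ w ∈ T.ker, differential F E ψ y w ∈ tangentImage n E ι q := fun w hw ↦ by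
      refine hf.ker_le q (hq ▸ hψy) ?_
      rw [hq]
      exact (differential_apply_of_comp_eq ψ.open_source hy (hf.mdifferentiableAt hψy)
        (hψ.mdifferentiableAt hy) hfψ w).trans hw
    rw [σ.pullback_apply, ← hq]
    exact hι.bilin_eq_zero (htangent u hu) (htangent v hv)

variable [FiniteDimensional ℝ E]

theorem injective_differential_prodMk {N N' : Set X} {f f' : X → ℝN}
    (hf : IsLocalEquation n E ι N f) (hf' : IsLocalEquation n E ι' N' f')
    (hdim : Module.finrank ℝ E = 2 * n) {p : L} {q : L'} (hpq : ι p = ι' q) (hp : ι p ∈ N)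
    (hq : ι p ∈ N') (htrans : tangentImage n E ι p ⊔ tangentImage n E ι' q = ⊤) :
    Function.Injective (differential E (ℝN × ℝN) (fun y ↦ (f y, f' y)) (ι p)) := by
  have hdisjoint : tangentImage n E ι p ⊓ tangentImage n E ι' q = ⊥ :=
    inf_eq_bot_of_sup_eq_top_of_finrank_le (by
      have := finrank_tangentImage_le (n := n) (E := E) ι p
      have := finrank_tangentImage_le (n := n) (E := E) ι' q
      omega) htrans
  have hprod : differential E (ℝN × ℝN) (fun y ↦ (f y, f' y)) (ι p) =
      (differential E ℝN f (ι p)).prod (differential E ℝN f' (ι p)) :=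
    have h := (hf.mdifferentiableAt hp).hasMFDerivAt
    have h' := (hf'.mdifferentiableAt hq).hasMFDerivAt
    HasMFDerivAt.mfderiv ⟨h.1.prodMk h'.1, h.2.prodMk h'.2⟩
  refine (injective_iff_map_eq_zero _).2 fun w hw ↦ ?_
  rw [hprod, ContinuousLinearMap.prod_apply, Prod.mk_eq_zero] at hw
  rw [← Submodule.mem_bot ℝ, ← hdisjoint]
  refine ⟨hf.ker_le p hp hw.1, hf'.ker_le q (hpq ▸ hq) ?_⟩
  rw [← hpq]
  exact hw.2

variable [IsManifold 𝓘(ℝ, E) ∞ X]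

theorem exists_straightening (hι : IsLagrangianEmbedding n σ ι)
    (hι' : IsLagrangianEmbedding n σ ι') {p : L} {q : L'} (hpq : ι p = ι' q)
    (htrans : tangentImage n E ι p ⊔ tangentImage n E ι' q = ⊤) :
    ∃ ψ : OpenPartialHomeomorph (ℝN × ℝN) X, IsPartialDiffeo (ℝN × ℝN) E ψ ∧
      0 ∈ ψ.source ∧ ψ 0 = ι p ∧
      (∀ y ∈ ψ.source, ψ y ∈ range ι ↔ y.1 = 0) ∧
      (∀ y ∈ ψ.source, ψ y ∈ range ι' ↔ y.2 = 0) ∧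
      IsLagrangianOn (σ.pullback ψ) ψ.source (ContinuousLinearMap.fst ℝ ℝN ℝN).ker ∧
      IsLagrangianOn (σ.pullback ψ) ψ.source (ContinuousLinearMap.snd ℝ ℝN ℝN).ker := by
  have hdim : Module.finrank ℝ E = n + Module.finrank ℝ ℝN := by
    rw [hι.half_dim, finrank_euclideanSpace_fin, two_mul]
  obtain ⟨N, f, hp, hf⟩ := exists_isLocalEquation (G := ℝN) hι.isSmoothEmbedding hdim p
  obtain ⟨N', f', hq, hf'⟩ := exists_isLocalEquation (G := ℝN) hι'.isSmoothEmbedding hdim q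
  rw [← hpq] at hq
  obtain ⟨ψ, hψ, hpψ, hψN, hfψ⟩ := exists_isPartialDiffeo_rightInverse
    (hf.isOpen.inter hf'.isOpen) (H := fun y ↦ (f y, f' y))
    ((hf.smooth.mono inter_subset_left).prodMk_space (hf'.smooth.mono inter_subset_right))
    ⟨hp, hq⟩ (injective_differential_prodMk hf hf' hι.half_dim hpq hp hq htrans)
    (by rw [hdim, Module.finrank_prod, finrank_euclideanSpace_fin])
  have hψN₁ := hψN.trans inter_subset_left
  have hψN₂ := hψN.trans inter_subset_right
  have hfst : ∀ y ∈ ψ.source, f (ψ y) = y.1 := fun y hy ↦ congrArg Prod.fst (hfψ y hy)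
  have hsnd : ∀ y ∈ ψ.source, f' (ψ y) = y.2 := fun y hy ↦ congrArg Prod.snd (hfψ y hy)
  have hsymm : ψ.symm (ι p) = 0 := by
    rw [← hfψ _ (ψ.map_target hpψ), ψ.right_inv hpψ, (hf.mem_range_iff _ hp).1 ⟨p, rfl⟩,
      (hf'.mem_range_iff _ hq).1 ⟨q, hpq.symm⟩, Prod.mk_zero_zero]
  have hdim₂ : Module.finrank ℝ (ℝN × ℝN) = 2 * Module.finrank ℝ ℝN := by
    rw [Module.finrank_prod, two_mul]
  refine ⟨ψ, hψ, hsymm ▸ ψ.map_target hpψ, hsymm ▸ ψ.right_inv hpψ, fun y hy ↦ ?_,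
    fun y hy ↦ ?_, hf.isLagrangianOn_pullback hι hψ hψN₁ Prod.fst_surjective hfst hdim₂,
    hf'.isLagrangianOn_pullback hι' hψ hψN₂ Prod.snd_surjective hsnd hdim₂⟩
  · rw [hf.mem_range_iff _ (hψN₁ (ψ.map_source hy)), hfst y hy]
  · rw [hf'.mem_range_iff _ (hψN₂ (ψ.map_source hy)), hsnd y hy]

/-- `φ` is a Darboux chart of `X` centered at `x`, defined on an open subset of `ℂⁿ`, in which the
subset `A` is `√-1 ℝⁿ` and the subset `B` is `ℝⁿ`. -/
structure IsAdaptedDarbouxChartAt (σ : SymplecticForm E X) (A B : Set X) (x : X)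
    (φ : OpenPartialHomeomorph (CSpace n) X) : Prop extends IsPartialDiffeo (CSpace n) E φ where
  zero_mem : 0 ∈ φ.source
  map_zero : φ 0 = x
  pullback : ∀ z ∈ φ.source, σ.pullback φ z = stdSymplecticForm n
  imag : ∀ z ∈ φ.source, φ z ∈ A ↔ z ∈ imagPlane n
  real : ∀ z ∈ φ.source, φ z ∈ B ↔ z ∈ realPlane n

theorem exists_isAdaptedDarbouxChartAt (hι : IsLagrangianEmbedding n σ ι)
    (hι' : IsLagrangianEmbedding n σ ι') {p : L} {q : L'} (hpq : ι p = ι' q)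
    (htrans : tangentImage n E ι p ⊔ tangentImage n E ι' q = ⊤) :
    ∃ φ : OpenPartialHomeomorph (CSpace n) X,
      IsAdaptedDarbouxChartAt σ (range ι) (range ι') (ι p) φ := by
  obtain ⟨ψ, hψ, h0, hψ0, hψι, hψι', hfst, hsnd⟩ := exists_straightening hι hι' hpq htrans
  obtain ⟨e, h0e, he0, heψ, he, hesymm, hpull, hpreserve⟩ := exists_relative_darboux_chart
    ψ.open_source h0 (σ.contDiffOn_pullback ψ.open_source hψ.smooth)
    (fun y _ ↦ σ.pullback_skew ψ y)
    (isInvertible_of_nondegenerate fun _ ↦ σ.eq_zero_of_pullback_eq_zero hψ h0)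
    (fun y hy ↦ σ.isClosedFormAt_pullback ψ.open_source hψ.smooth hy)
  obtain ⟨Λ, hΛ, hΛimag, hΛreal⟩ := exists_linear_symplectic_equiv (σ.pullback_skew ψ 0)
    (fun _ ↦ σ.eq_zero_of_pullback_eq_zero hψ h0)
    (fun a a' ↦ hsnd.isotropic 0 (zero_mem _) h0 (a, 0) rfl (a', 0) rfl)
    (fun b b' ↦ hfst.isotropic 0 (zero_mem _) h0 (0, b) rfl (0, b') rfl)
  have hΛe : ∀ z, Λ z ∈ e.source → e (Λ z) ∈ ψ.source := fun z hz ↦ heψ (e.map_source hz)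
  refine ⟨Λ.toHomeomorph.toOpenPartialHomeomorph ≫ₕ e ≫ₕ ψ,
    (isPartialDiffeo_continuousLinearEquiv Λ).trans
      ((isPartialDiffeo_of_contDiffOn he hesymm).trans hψ), ?_, ?_, ?_, ?_, ?_⟩
  · simp [h0e, he0, h0]
  · simp [he0, hψ0]
  · rintro z ⟨-, hz : Λ z ∈ e.source, -⟩
    have hediff : DifferentiableAt ℝ e (Λ z) :=
      (he.contDiffAt (e.open_source.mem_nhds hz)).differentiableAt (by simp)
    ext u v
    refine (σ.pullback_comp (f := e ∘ Λ) (hψ.mdifferentiableAt (hΛe z hz))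
      (hediff.comp z Λ.differentiableAt) u v).trans ?_
    rw [fderiv_comp z hediff Λ.differentiableAt, Λ.fderiv]
    exact (hpull (Λ z) hz (Λ u) (Λ v)).trans (hΛ u v)
  · rintro z ⟨-, hz : Λ z ∈ e.source, -⟩
    exact (hψι _ (hΛe z hz)).trans ((hpreserve _ hfst _ hz).trans (hΛimag z))
  · rintro z ⟨-, hz : Λ z ∈ e.source, -⟩
    exact (hψι' _ (hΛe z hz)).trans ((hpreserve _ hsnd _ hz).trans (hΛreal z))

end AdaptedDarbouxCharts

/-! ### Polar decomposition of a symplectic form with respect to an inner product -/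

section Spectral

variable {V : Type*} [AddCommGroup V] [Module ℝ V]

/-- The inner product space structure defined by a symmetric positive definite bilinear form,
through which the spectral theorem is applied to forms that do not induce the given norm. -/
abbrev innerProductCore (g : V →ₗ[ℝ] V →ₗ[ℝ] ℝ) (hsymm : ∀ u v, g u v = g v u)
    (hpos : ∀ u, u ≠ 0 → 0 < g u u) : InnerProductSpace.Core ℝ V where
  inner u v := g u v
  conj_inner_symm u v := hsymm v u
  re_inner_nonneg u := by
    rcases eq_or_ne u 0 with rfl | hu
    · simp
    · exact (hpos u hu).le
  add_left u v w := by simp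
  smul_left u v r := by simp
  definite u hu := by
    by_contra hne
    exact (hpos u hne).ne' hu

theorem exists_orthonormal_eigenbasis [FiniteDimensional ℝ V] {g : V →ₗ[ℝ] V →ₗ[ℝ] ℝ}
    (hsymm : ∀ u v, g u v = g v u) (hpos : ∀ u, u ≠ 0 → 0 < g u u) {T : V →ₗ[ℝ] V}
    (hT : ∀ u v, g u (T v) = g (T u) v) :
    ∃ (b : Module.Basis (Fin (Module.finrank ℝ V)) ℝ V) (μ : Fin (Module.finrank ℝ V) → ℝ),
      (∀ i j, g (b i) (b j) = if i = j then 1 else 0) ∧ ∀ i, T (b i) = μ i • b i := by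
  let _ := (innerProductCore g hsymm hpos).toNormedAddCommGroup
  let _ : InnerProductSpace ℝ V := InnerProductSpace.ofCore (innerProductCore g hsymm hpos).toCore
  have hTsymm : T.IsSymmetric := fun u v ↦ (hT u v).symm
  let b := hTsymm.eigenvectorBasis rfl
  refine ⟨b.toBasis, hTsymm.eigenvalues rfl, fun i j ↦ ?_, fun i ↦ ?_⟩
  · rw [b.coe_toBasis]
    exact orthonormal_iff_ite.1 b.orthonormal i j
  · rw [b.coe_toBasis]
    exact hTsymm.apply_eigenvectorBasis rfl i

end Spectral

section PositiveOperators

variable {V : Type*} [NormedAddCommGroup V] [NormedSpace ℝ V]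

/-- The bilinear form `g` is an inner product, not necessarily the one defining the norm. -/
structure IsInnerForm (g : V →L[ℝ] V →L[ℝ] ℝ) : Prop where
  symm : ∀ u v, g u v = g v u
  pos : ∀ u, u ≠ 0 → 0 < g u u

/-- The endomorphism `T` is self-adjoint and positive definite with respect to `g`. -/
structure IsPosSelfAdjoint (g : V →L[ℝ] V →L[ℝ] ℝ) (T : V →L[ℝ] V) : Prop where
  selfAdjoint : ∀ u v, g u (T v) = g (T u) v
  pos : ∀ u, u ≠ 0 → 0 < g u (T u)

theorem IsInnerForm.ext {g : V →L[ℝ] V →L[ℝ] ℝ} (hg : IsInnerForm g) {u v : V}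
    (h : ∀ w, g u w = g v w) : u = v := by
  by_contra hne
  have hpos := hg.pos (u - v) (sub_ne_zero.2 hne)
  rw [map_sub g, _root_.sub_apply, h, sub_self] at hpos
  exact hpos.false

variable {g : V →L[ℝ] V →L[ℝ] ℝ}

theorem isPosSelfAdjoint_of_eigenbasis (hg : IsInnerForm g) {κ : Type*} [Finite κ] [DecidableEq κ]
    {b : Module.Basis κ ℝ V} {s : κ → ℝ} {S : V →L[ℝ] V}
    (horth : ∀ i j, g (b i) (b j) = if i = j then 1 else 0) (hs : ∀ i, 0 < s i)
    (hS : ∀ i, S (b i) = s i • b i) : IsPosSelfAdjoint g S := by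
  cases nonempty_fintype κ
  have hcoord : ∀ u i, g u (b i) = b.repr u i := fun u i ↦ by
    conv_lhs => rw [← b.sum_repr u]
    simp only [map_sum, map_smul, _root_.sum_apply, _root_.smul_apply, horth, smul_eq_mul,
      mul_ite, mul_one, mul_zero, Finset.sum_ite_eq', Finset.mem_univ, if_true]
  have hgS : ∀ u v, g u (S v) = ∑ i, s i * (b.repr u i * b.repr v i) := fun u v ↦ by
    conv_lhs => rw [← b.sum_repr v]
    simp only [map_sum, map_smul, hS, smul_eq_mul, hcoord]
    exact Finset.sum_congr rfl fun i _ ↦ by ring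
  refine ⟨fun u v ↦ ?_, fun u hu ↦ ?_⟩
  · rw [hg.symm (S u), hgS, hgS]
    exact Finset.sum_congr rfl fun i _ ↦ by ring
  · obtain ⟨i, hi⟩ : ∃ i, b.repr u i ≠ 0 := by
      by_contra! hzero
      exact hu (b.ext_elem fun i ↦ by simp [hzero i])
    rw [hgS]
    exact Finset.sum_pos' (fun j _ ↦ mul_nonneg (hs j).le (mul_self_nonneg _))
      ⟨i, Finset.mem_univ i, mul_pos (hs i) (mul_self_pos.2 hi)⟩

variable [FiniteDimensional ℝ V]

theorem IsPosSelfAdjoint.exists_eigenbasis (hg : IsInnerForm g) {T : V →L[ℝ] V}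
    (hT : IsPosSelfAdjoint g T) :
    ∃ (b : Module.Basis (Fin (Module.finrank ℝ V)) ℝ V) (μ : Fin (Module.finrank ℝ V) → ℝ),
      (∀ i j, g (b i) (b j) = if i = j then 1 else 0) ∧ (∀ i, 0 < μ i) ∧
        ∀ i, T (b i) = μ i • b i := by
  obtain ⟨b, μ, horth, heigen⟩ := exists_orthonormal_eigenbasis (g := g.toLinearMap₁₂)
    (T := (T : V →ₗ[ℝ] V)) hg.symm hg.pos hT.selfAdjoint
  refine ⟨b, μ, horth, fun i ↦ ?_, heigen⟩
  have hpos : 0 < g (b i) (T (b i)) := hT.pos (b i) (b.ne_zero i)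
  rw [show T (b i) = μ i • b i from heigen i, map_smul, smul_eq_mul] at hpos
  exact pos_of_mul_pos_left hpos (hg.pos _ (b.ne_zero i)).le

theorem IsPosSelfAdjoint.exists_sqrt (hg : IsInnerForm g) {T : V →L[ℝ] V}
    (hT : IsPosSelfAdjoint g T) : ∃ S, IsPosSelfAdjoint g S ∧ S ∘L S = T := by
  obtain ⟨b, μ, horth, hμ, heigen⟩ := hT.exists_eigenbasis hg
  let S : V →L[ℝ] V := LinearMap.toContinuousLinearMap (b.constr ℝ fun i ↦ √(μ i) • b i)
  have hS : ∀ i, S (b i) = √(μ i) • b i := fun i ↦ b.constr_basis ℝ _ i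
  refine ⟨S, isPosSelfAdjoint_of_eigenbasis hg horth (fun i ↦ Real.sqrt_pos.2 (hμ i)) hS, ?_⟩
  refine ContinuousLinearMap.coe_injective (b.ext fun i ↦ ?_)
  change S (S (b i)) = T (b i)
  rw [hS, map_smul, hS, smul_smul, Real.mul_self_sqrt (hμ i).le, heigen]

theorem eq_zero_of_sylvester (hg : IsInnerForm g) {S S' H : V →L[ℝ] V}
    (hS : ∀ u, u ≠ 0 → 0 < g u (S u)) (hS' : IsPosSelfAdjoint g S')
    (h : S ∘L H + H ∘L S' = 0) : H = 0 := by
  obtain ⟨b, μ, -, hμ, heigen⟩ := hS'.exists_eigenbasis hg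
  refine ContinuousLinearMap.coe_injective (b.ext fun i ↦ ?_)
  by_contra hne
  change H (b i) ≠ 0 at hne
  have hSH : S (H (b i)) = -(μ i • H (b i)) := by
    rw [eq_neg_iff_add_eq_zero, ← map_smul, ← heigen]
    exact congrArg (fun T : V →L[ℝ] V ↦ T (b i)) h
  have hpos := hS _ hne
  rw [hSH, map_neg, map_smul, smul_eq_mul] at hpos
  linarith [mul_pos (hμ i) (hg.pos _ hne)]

theorem eventually_forall_pos (hg : ∀ u, u ≠ 0 → 0 < g u u) :
    ∀ᶠ g' : V →L[ℝ] V →L[ℝ] ℝ in 𝓝 g, ∀ u, u ≠ 0 → 0 < g' u u := by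
  have hcont : Continuous fun p : (V →L[ℝ] V →L[ℝ] ℝ) × V ↦ p.1 p.2 p.2 := by fun_prop
  have hsphere := (isCompact_sphere (0 : V) 1).eventually_forall_of_forall_eventually
    (P := fun (g' : V →L[ℝ] V →L[ℝ] ℝ) u ↦ 0 < g' u u) fun u hu ↦
      (hcont.tendsto (g, u)).eventually_const_lt (hg u (ne_zero_of_mem_unit_sphere ⟨u, hu⟩))
  filter_upwards [hsphere] with g' hg' u hu
  have hnorm : ‖u‖ ≠ 0 := norm_ne_zero_iff.2 hu
  have hunit := hg' (‖u‖⁻¹ • u) (by simp [norm_smul, hnorm])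
  simp only [map_smul, _root_.smul_apply, smul_eq_mul] at hunit
  have hinv : 0 < ‖u‖⁻¹ := inv_pos.2 (norm_pos_iff.2 hu)
  exact pos_of_mul_pos_right (pos_of_mul_pos_right hunit hinv.le) hinv.le

end PositiveOperators

section Polar

variable {V : Type*} [NormedAddCommGroup V] [NormedSpace ℝ V]

/-- `J` is the complex structure compatible with `η` and orthogonal for `g`. -/
structure IsPolar (g η : V →L[ℝ] V →L[ℝ] ℝ) (J : V →L[ℝ] V) : Prop where
  sq : ∀ u, J (J u) = -u
  metric : ∀ u v, g (J u) (J v) = g u v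
  symplectic : ∀ u v, η (J u) (J v) = η u v
  pos : ∀ u, u ≠ 0 → 0 < η u (J u)

/-- The endomorphism `A` such that `g(u, A v) = η(u, v)`, for an inner product `g`. -/
def representingEnd (g η : V →L[ℝ] V →L[ℝ] ℝ) : V →L[ℝ] V :=
  g.inverse ∘L η.flip

variable [FiniteDimensional ℝ V] {g η : V →L[ℝ] V →L[ℝ] ℝ}

theorem IsInnerForm.isInvertible (hg : IsInnerForm g) : g.IsInvertible :=
  isInvertible_of_nondegenerate fun _ hu ↦ hg.ext fun w ↦ by simp [hu w]

theorem apply_representingEnd (hg : IsInnerForm g) (u v : V) :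
    g u (representingEnd g η v) = η u v := by
  rw [hg.symm]
  obtain ⟨e, rfl⟩ := hg.isInvertible
  simp [representingEnd]

theorem apply_representingEnd_left (hg : IsInnerForm g) (hη : ∀ u v, η u v = -η v u) (u v : V) :
    g (representingEnd g η u) v = -g u (representingEnd g η v) := by
  rw [hg.symm, apply_representingEnd hg, apply_representingEnd hg, hη]

theorem isInvertible_representingEnd (hg : IsInnerForm g) (hη : ∀ u v, η u v = -η v u)
    (hnondeg : ∀ u, (∀ v, η u v = 0) → u = 0) : (representingEnd g η).IsInvertible := by
  have hinj : Function.Injective (representingEnd g η : V →ₗ[ℝ] V) :=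
    (injective_iff_map_eq_zero _).2 fun u hu ↦ hnondeg u fun v ↦ by
      rw [hη, ← apply_representingEnd hg, show representingEnd g η u = 0 from hu, map_zero,
        neg_zero]
  exact ⟨(LinearEquiv.ofInjectiveEndo _ hinj).toContinuousLinearEquiv, rfl⟩

namespace IsPolar

variable {J J' : V →L[ℝ] V}

theorem representingEnd_comm (hg : IsInnerForm g) (hJ : IsPolar g η J) (v : V) :
    representingEnd g η (J v) = J (representingEnd g η v) := by
  have hηJ : ∀ u, η u (J v) = -η (J u) v := fun u ↦ by
    rw [← hJ.symplectic u (J v), hJ.sq, map_neg]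
  have hgJ : ∀ u w, g u (J w) = -g (J u) w := fun u w ↦ by
    rw [← hJ.metric u (J w), hJ.sq, map_neg]
  refine hg.ext fun u ↦ ?_
  rw [hg.symm, apply_representingEnd hg, hηJ, hg.symm, hgJ, apply_representingEnd hg]

theorem isPosSelfAdjoint (hg : IsInnerForm g) (hη : ∀ u v, η u v = -η v u)
    (hJ : IsPolar g η J) : IsPosSelfAdjoint g (representingEnd g η ∘L J) where
  selfAdjoint u v := by
    change g u (representingEnd g η (J v)) = g (representingEnd g η (J u)) v
    rw [apply_representingEnd_left hg hη, apply_representingEnd hg, apply_representingEnd hg,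
      ← hJ.symplectic u (J v), hJ.sq, map_neg]
  pos u hu := by
    change 0 < g u (representingEnd g η (J u))
    rw [apply_representingEnd hg]
    exact hJ.pos u hu

theorem unique (hg : IsInnerForm g) (hη : ∀ u v, η u v = -η v u) (hJ : IsPolar g η J)
    (hJ' : IsPolar g η J') : J = J' := by
  have hzero : representingEnd g η ∘L (J - J') = 0 := by
    refine eq_zero_of_sylvester hg (hJ.isPosSelfAdjoint hg hη).pos
      (hJ'.isPosSelfAdjoint hg hη) ?_
    ext u
    simp [hJ.representingEnd_comm hg, hJ'.representingEnd_comm hg, hJ.sq, hJ'.sq]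
  have hnondeg : ∀ u, (∀ v, η u v = 0) → u = 0 := fun u hu ↦ by
    by_contra hne
    exact (hJ.pos u hne).ne' (hu (J u))
  obtain ⟨a, ha⟩ := isInvertible_representingEnd hg hη hnondeg
  ext u
  refine sub_eq_zero.1 (a.map_eq_zero_iff.1 ?_)
  have h := congrArg (fun T : V →L[ℝ] V ↦ T u) hzero
  rwa [← ha] at h

end IsPolar

theorem isPosSelfAdjoint_neg_representingEnd_sq (hg : IsInnerForm g) (hη : ∀ u v, η u v = -η v u)
    (hnondeg : ∀ u, (∀ v, η u v = 0) → u = 0) :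
    IsPosSelfAdjoint g (-(representingEnd g η ∘L representingEnd g η)) where
  selfAdjoint u v := by simp [apply_representingEnd_left hg hη]
  pos u hu := by
    obtain ⟨a, ha⟩ := isInvertible_representingEnd hg hη hnondeg
    have hne : representingEnd g η u ≠ 0 := by
      rw [← ha]
      exact a.map_ne_zero_iff.2 hu
    have hpos := hg.pos _ hne
    rw [apply_representingEnd_left hg hη] at hpos
    simpa using hpos

theorem isPolar_inverse_comp_sqrt (hg : IsInnerForm g) (hη : ∀ u v, η u v = -η v u)
    {R : V →L[ℝ] V} (hA : (representingEnd g η).IsInvertible) (hR : IsPosSelfAdjoint g R)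
    (hsq : R ∘L R = -(representingEnd g η ∘L representingEnd g η)) :
    IsPolar g η ((representingEnd g η).inverse ∘L R) := by
  have hRR : ∀ u, R (R u) = -representingEnd g η (representingEnd g η u) := fun u ↦
    congrArg (fun T : V →L[ℝ] V ↦ T u) hsq
  have hcomm : representingEnd g η ∘L R - R ∘L representingEnd g η = 0 := by
    refine eq_zero_of_sylvester hg hR.pos hR ?_
    ext u
    simp [hRR, sub_eq_add_neg]
  obtain ⟨a, ha⟩ := hA
  have haR : ∀ u, a (R u) = R (a u) := fun u ↦ by
    have h := congrArg (fun T : V →L[ℝ] V ↦ T u) hcomm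
    rw [← ha] at h
    exact sub_eq_zero.1 h
  have haR' : ∀ u, a.symm (R u) = R (a.symm u) := fun u ↦
    a.injective (by rw [haR, a.apply_symm_apply, a.apply_symm_apply])
  have hga : ∀ u v, g u (a v) = η u v := fun u v ↦ by
    rw [← apply_representingEnd (η := η) hg, ← ha]
    rfl
  have hga' : ∀ u v, g (a u) v = -g u (a v) := fun u v ↦ by rw [hg.symm, hga, hga, hη]
  have haa : ∀ u, a.symm (a.symm (R (R u))) = -u := fun u ↦ by
    rw [hRR, ← ha]
    simp
  have hgJ : ∀ u v, g (a.symm (R u)) v = -g u (a.symm (R v)) := fun u v ↦ by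
    obtain ⟨w, rfl⟩ := a.surjective v
    rw [← haR, a.symm_apply_apply, hR.selfAdjoint, ← a.apply_symm_apply (R u), hga',
      a.apply_symm_apply, neg_neg]
  have hmetric : ∀ u v, g (a.symm (R u)) (a.symm (R v)) = g u v := fun u v ↦ by
    rw [hgJ, ← haR', haa, map_neg, neg_neg]
  rw [← ha, ContinuousLinearMap.inverse_equiv]
  refine ⟨fun u ↦ ?_, hmetric, fun u v ↦ ?_, fun u hu ↦ ?_⟩
  · change a.symm (R (a.symm (R u))) = -u
    rw [← haR', haa]
  · change η (a.symm (R u)) (a.symm (R v)) = η u v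
    rw [← hga, ← hga u v, a.apply_symm_apply, ← hmetric u (a v), ← haR, a.symm_apply_apply]
  · change 0 < η u (a.symm (R u))
    rw [← hga, a.apply_symm_apply]
    exact hR.pos u hu

end Polar

/-! ### Smoothness of the polar decomposition -/

section SmoothPolar

variable {V : Type*} [NormedAddCommGroup V] [NormedSpace ℝ V] [FiniteDimensional ℝ V]
  {g η : V →L[ℝ] V →L[ℝ] ℝ}

theorem contDiffAt_inverse_of_isInvertible {W W' : Type*} [NormedAddCommGroup W] [NormedSpace ℝ W]
    [CompleteSpace W] [NormedAddCommGroup W'] [NormedSpace ℝ W'] {f : W →L[ℝ] W'}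
    (hf : f.IsInvertible) :
    ContDiffAt ℝ ∞ (ContinuousLinearMap.inverse : (W →L[ℝ] W') → W' →L[ℝ] W) f := by
  obtain ⟨e, rfl⟩ := hf
  exact contDiffAt_map_inverse e

theorem contDiffAt_representingEnd (hg : g.IsInvertible) :
    ContDiffAt ℝ ∞ (fun p : (V →L[ℝ] V →L[ℝ] ℝ) × (V →L[ℝ] V →L[ℝ] ℝ) ↦
      representingEnd p.1 p.2) (g, η) := by
  have := FiniteDimensional.complete ℝ V
  exact ((contDiffAt_inverse_of_isInvertible hg).comp (g, η) contDiffAt_fst).clm_comp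
    ((ContinuousLinearMap.flipₗᵢ ℝ V V ℝ).contDiff.contDiffAt.comp (g, η) contDiffAt_snd)

theorem exists_local_sqrt (hg : IsInnerForm g) {S : V →L[ℝ] V} (hS : IsPosSelfAdjoint g S) :
    ∃ e : OpenPartialHomeomorph (V →L[ℝ] V) (V →L[ℝ] V), (∀ R, e R = R ∘L R) ∧ S ∈ e.source ∧
      ContDiffOn ℝ ∞ e.symm e.target := by
  have := FiniteDimensional.complete ℝ V
  let C := ContinuousLinearMap.compL ℝ V V V
  have hsmooth : ContDiff ℝ ∞ fun R : V →L[ℝ] V ↦ R ∘L R := contDiff_id.clm_comp contDiff_id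
  have hderiv : HasFDerivAt (fun R : V →L[ℝ] V ↦ R ∘L R) (C S + C.flip S) S :=
    (hasFDerivAt_id S).clm_comp (hasFDerivAt_id S)
  have hinj : Function.Injective (C S + C.flip S : (V →L[ℝ] V) →ₗ[ℝ] V →L[ℝ] V) :=
    (injective_iff_map_eq_zero _).2 fun _ hH ↦ eq_zero_of_sylvester hg hS.pos hS hH
  let D : (V →L[ℝ] V) ≃L[ℝ] (V →L[ℝ] V) :=
    (LinearEquiv.ofInjectiveEndo _ hinj).toContinuousLinearEquiv
  obtain ⟨e, he, hSe, -, -, hesymm⟩ := exists_openPartialHomeomorph_of_contDiffOn isOpen_univ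
    hsmooth.contDiffOn (mem_univ S) D hderiv
  exact ⟨e, fun R ↦ by rw [he], hSe, hesymm⟩

/-- On a domain of injectivity of the squaring map, a square root coincides with its `g`-adjoint,
which is another root of the same operator. -/
theorem selfAdjoint_of_mem_source (hg : IsInnerForm g)
    {e : OpenPartialHomeomorph (V →L[ℝ] V) (V →L[ℝ] V)} (he : ∀ R, e R = R ∘L R)
    {R : V →L[ℝ] V} (hR : R ∈ e.source) (hadjoint : representingEnd g (g ∘L R) ∈ e.source)
    (hsq : ∀ u v, g u (R (R v)) = g (R (R u)) v) (u v : V) : g u (R v) = g (R u) v := by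
  have happly : ∀ u v, g u (representingEnd g (g ∘L R) v) = g (R u) v := fun u v ↦
    apply_representingEnd hg u v
  have heq : representingEnd g (g ∘L R) = R := by
    refine e.injOn hadjoint hR ?_
    rw [he, he]
    ext w
    refine hg.ext fun z ↦ ?_
    rw [hg.symm, hg.symm _ z]
    exact (happly z _).trans ((happly (R z) w).trans (hsq z w).symm)
  rw [← happly u v, heq]

theorem eventually_isPosSelfAdjoint {P : Type*} [TopologicalSpace P] {p₀ : P}
    {G : P → V →L[ℝ] V →L[ℝ] ℝ} (hG : ContinuousAt G p₀) (hG₀ : IsInnerForm (G p₀))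
    {R : P → V →L[ℝ] V} (hR : ContinuousAt R p₀) (hR₀ : IsPosSelfAdjoint (G p₀) (R p₀))
    {e : OpenPartialHomeomorph (V →L[ℝ] V) (V →L[ℝ] V)} (he : ∀ R, e R = R ∘L R)
    (hR₀e : R p₀ ∈ e.source) :
    ∀ᶠ p in 𝓝 p₀, IsInnerForm (G p) →
      (∀ u v, G p u (R p (R p v)) = G p (R p (R p u)) v) → IsPosSelfAdjoint (G p) (R p) := by
  have hGR : ContinuousAt (fun p ↦ G p ∘L R p) p₀ := hG.clm_comp hR
  have hadjoint₀ : representingEnd (G p₀) (G p₀ ∘L R p₀) = R p₀ := by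
    ext v
    refine hG₀.ext fun u ↦ ?_
    rw [hG₀.symm, apply_representingEnd hG₀, hG₀.symm _ u, hR₀.selfAdjoint]
    rfl
  have hadjoint : ContinuousAt (fun p ↦ representingEnd (G p) (G p ∘L R p)) p₀ :=
    (contDiffAt_representingEnd hG₀.isInvertible).continuousAt.comp (f := fun p ↦
      (G p, G p ∘L R p)) (hG.prodMk hGR)
  filter_upwards [hR.eventually (e.open_source.mem_nhds hR₀e),
    hadjoint.eventually (e.open_source.mem_nhds (hadjoint₀.symm ▸ hR₀e :
      representingEnd (G p₀) (G p₀ ∘L R p₀) ∈ e.source)),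
    hGR.eventually (eventually_forall_pos fun u hu ↦
      (hR₀.pos u hu).trans_eq (hR₀.selfAdjoint u u))] with p hRe hadjointe hpos hGp hsq
  have hself := selfAdjoint_of_mem_source hGp he hRe hadjointe hsq
  exact ⟨hself, fun u hu ↦ (hpos u hu).trans_eq (hself u u).symm⟩

theorem exists_smooth_polar (hg : IsInnerForm g) (hη : ∀ u v, η u v = -η v u)
    (hnondeg : ∀ u, (∀ v, η u v = 0) → u = 0) :
    ∃ Ψ : (V →L[ℝ] V →L[ℝ] ℝ) × (V →L[ℝ] V →L[ℝ] ℝ) → V →L[ℝ] V,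
      ContDiffAt ℝ ∞ Ψ (g, η) ∧ ∀ᶠ p in 𝓝 (g, η), IsInnerForm p.1 →
        (∀ u v, p.2 u v = -p.2 v u) → IsPolar p.1 p.2 (Ψ p) := by
  have := FiniteDimensional.complete ℝ V
  let A : (V →L[ℝ] V →L[ℝ] ℝ) × (V →L[ℝ] V →L[ℝ] ℝ) → V →L[ℝ] V :=
    fun p ↦ representingEnd p.1 p.2
  have hA : ContDiffAt ℝ ∞ A (g, η) := contDiffAt_representingEnd hg.isInvertible
  have hAinv : (A (g, η)).IsInvertible := isInvertible_representingEnd hg hη hnondeg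
  obtain ⟨S, hS, hSS⟩ :=
    (isPosSelfAdjoint_neg_representingEnd_sq hg hη hnondeg).exists_sqrt hg
  obtain ⟨e, he, hSe, hesymm⟩ := exists_local_sqrt hg hS
  have hsq₀ : -(A (g, η) ∘L A (g, η)) = e S := hSS.symm.trans (he S).symm
  have hsqe : -(A (g, η) ∘L A (g, η)) ∈ e.target := hsq₀ ▸ e.map_source hSe
  have hsq : ContDiffAt ℝ ∞ (fun p ↦ -(A p ∘L A p)) (g, η) := (hA.clm_comp hA).neg
  let R : (V →L[ℝ] V →L[ℝ] ℝ) × (V →L[ℝ] V →L[ℝ] ℝ) → V →L[ℝ] V :=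
    fun p ↦ e.symm (-(A p ∘L A p))
  have hR : ContDiffAt ℝ ∞ R (g, η) :=
    (hesymm.contDiffAt (e.open_target.mem_nhds hsqe)).comp (g, η) hsq
  have hR₀ : R (g, η) = S := (congrArg e.symm hsq₀).trans (e.left_inv hSe)
  refine ⟨fun p ↦ (A p).inverse ∘L R p,
    ((contDiffAt_inverse_of_isInvertible hAinv).comp (g, η) hA).clm_comp hR, ?_⟩
  filter_upwards [hA.continuousAt.eventually (eventually_isInvertible hAinv),
    hsq.continuousAt.eventually (e.open_target.mem_nhds hsqe),
    eventually_isPosSelfAdjoint continuousAt_fst hg hR.continuousAt (hR₀ ▸ hS) he (hR₀ ▸ hSe)]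
    with p hAp hpe hRp hp hskew
  have hRR : R p ∘L R p = -(A p ∘L A p) := (he _).symm.trans (e.right_inv hpe)
  have hRR' : ∀ u, R p (R p u) = -A p (A p u) := fun u ↦
    congrArg (fun T : V →L[ℝ] V ↦ T u) hRR
  refine isPolar_inverse_comp_sqrt hp hskew hAp (hRp hp fun u v ↦ ?_) hRR
  simp [hRR', A, apply_representingEnd_left hp hskew]

end SmoothPolar

/-! ### The almost complex structure of a Riemannian metric and a symplectic form -/

section BilinearComp

variable {V W : Type*} [NormedAddCommGroup V] [NormedSpace ℝ V] [NormedAddCommGroup W]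
  [NormedSpace ℝ W] {g η : W →L[ℝ] W →L[ℝ] ℝ}

theorem IsInnerForm.bilinearComp (hg : IsInnerForm g) {T : V →L[ℝ] W}
    (hT : Function.Injective T) : IsInnerForm (g.bilinearComp T T) where
  symm _ _ := hg.symm _ _
  pos _ hu := hg.pos _ ((map_ne_zero_iff T hT).2 hu)

theorem IsPolar.bilinearComp {J : W →L[ℝ] W} (hJ : IsPolar g η J) {T : V →L[ℝ] W}
    {T' : W →L[ℝ] V} (hT : ∀ u, T' (T u) = u) (hT' : ∀ w, T (T' w) = w) :
    IsPolar (g.bilinearComp T T) (η.bilinearComp T T) (T' ∘L J ∘L T) where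
  sq u := by simp [hT, hT', hJ.sq]
  metric u v := by simp [hT', hJ.metric]
  symplectic u v := by simp [hT', hJ.symplectic]
  pos u hu := by
    simpa [hT'] using hJ.pos (T u) ((map_ne_zero_iff T (Function.LeftInverse.injective hT)).2 hu)

theorem isInnerForm_innerSL (H : Type*) [NormedAddCommGroup H] [InnerProductSpace ℝ H] :
    IsInnerForm (innerSL ℝ : H →L[ℝ] H →L[ℝ] ℝ) where
  symm u v := real_inner_comm v u
  pos _ hu := real_inner_self_pos.2 hu

end BilinearComp

section FormFields

variable {E : Type*} [NormedAddCommGroup E] [NormedSpace ℝ E]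
  {F : Type*} [NormedAddCommGroup F] [NormedSpace ℝ F]
  {X : Type*} [TopologicalSpace X] [ChartedSpace E X]

/-- The expression in the chart at `x₀` of a field of bilinear forms on the tangent spaces of `X`,
as a function of the point `x` of `X` and not of its coordinates. -/
def formInChart (b : X → E →L[ℝ] E →L[ℝ] ℝ) (x₀ x : X) : E →L[ℝ] E →L[ℝ] ℝ :=
  (b x).bilinearComp (differential E E (chartAt E x₀).symm (chartAt E x₀ x))
    (differential E E (chartAt E x₀).symm (chartAt E x₀ x))

/-- Smoothness at `x₀` of a field of bilinear forms on the tangent spaces of `X`. -/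
def IsSmoothFormAt (b : X → E →L[ℝ] E →L[ℝ] ℝ) (x₀ : X) : Prop :=
  ContMDiffAt 𝓘(ℝ, E) 𝓘(ℝ, E →L[ℝ] E →L[ℝ] ℝ) ∞ (formInChart b x₀) x₀

theorem inCoordinates_tangentSpace [IsManifold 𝓘(ℝ, E) 1 X] {x₀ x : X}
    (hx : x ∈ (chartAt E x₀).source) (J : E →L[ℝ] E) :
    ContinuousLinearMap.inCoordinates E (TangentSpace 𝓘(ℝ, E)) E (TangentSpace 𝓘(ℝ, E))
      x₀ x x₀ x J = differential E E (chartAt E x₀) x ∘L J ∘L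
        differential E E (chartAt E x₀).symm (chartAt E x₀ x) := by
  have htriv := TangentBundle.continuousLinearMapAt_trivializationAt (I := 𝓘(ℝ, E)) hx
  have hsymm := TangentBundle.symmL_trivializationAt (I := 𝓘(ℝ, E)) hx
  simp only [mfld_simps, mfderivWithin_univ] at htriv hsymm
  unfold ContinuousLinearMap.inCoordinates
  rw [htriv, hsymm]
  rfl

variable [IsManifold 𝓘(ℝ, E) ∞ X]

theorem contMDiffAt_comp_chartAt {G : Type*} [NormedAddCommGroup G] [NormedSpace ℝ G] {f : E → G}
    {x₀ : X} (hf : ContDiffAt ℝ ∞ f (chartAt E x₀ x₀)) :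
    ContMDiffAt 𝓘(ℝ, E) 𝓘(ℝ, G) ∞ (fun x ↦ f (chartAt E x₀ x)) x₀ :=
  hf.contMDiffAt.comp x₀ <| (isPartialDiffeo_chartAt x₀).smooth.contMDiffAt <|
    (chartAt E x₀).open_source.mem_nhds (mem_chart_source E x₀)

theorem isSmoothFormAt_comp_differential {N : Set X} (hN : IsOpen N) {H : X → F}
    (hH : ContMDiffOn 𝓘(ℝ, E) 𝓘(ℝ, F) ∞ H N) {x₀ : X} (hx₀ : x₀ ∈ N)
    (b : F →L[ℝ] F →L[ℝ] ℝ) :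
    IsSmoothFormAt (fun x ↦ b.bilinearComp (differential E F H x) (differential E F H x)) x₀ := by
  let κ := chartAt E x₀
  have hκ : IsPartialDiffeo E E κ := isPartialDiffeo_chartAt x₀
  have hκx₀ : x₀ ∈ κ.source := mem_chart_source E x₀
  let t := κ.target ∩ κ.symm ⁻¹' N
  have ht : IsOpen t := κ.isOpen_inter_preimage_symm hN
  have hx₀t : κ x₀ ∈ t := ⟨κ.map_source hκx₀, by rwa [mem_preimage, κ.left_inv hκx₀]⟩
  have hderiv : ContDiffOn ℝ ∞ (fderiv ℝ (H ∘ κ.symm)) t :=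
    (contMDiffOn_iff_contDiffOn.1 <| hH.comp (hκ.smooth_symm.mono inter_subset_left)
      inter_subset_right).fderiv_of_isOpen ht (by simp)
  have hsmooth := (contDiffOn_bilinearComp contDiffOn_const hderiv hderiv).contDiffAt
    (ht.mem_nhds hx₀t) (f := fun y ↦ b.bilinearComp _ _)
  refine (contMDiffAt_comp_chartAt hsmooth).congr_of_eventuallyEq ?_
  filter_upwards [κ.open_source.mem_nhds hκx₀, hN.mem_nhds hx₀] with x hxκ hxN
  have hHx := ((hH x hxN).contMDiffAt (hN.mem_nhds hxN)).mdifferentiableAt (by simp)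
  change _ = b.bilinearComp (fderiv ℝ (H ∘ κ.symm) (κ x)) (fderiv ℝ (H ∘ κ.symm) (κ x))
  rw [(hκ.hasFDerivAt_comp_symm hxκ hHx).fderiv]
  rfl

theorem SymplecticForm.isSmoothFormAt (σ : SymplecticForm E X) (x₀ : X) :
    IsSmoothFormAt σ.bilin x₀ := by
  let κ := chartAt E x₀
  have hκx₀ : x₀ ∈ κ.source := mem_chart_source E x₀
  have hsmooth := (σ.contDiffOn_pullback κ.open_target
    (isPartialDiffeo_chartAt x₀).smooth_symm).contDiffAt
      (κ.open_target.mem_nhds (κ.map_source hκx₀))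
  refine (contMDiffAt_comp_chartAt hsmooth).congr_of_eventuallyEq ?_
  filter_upwards [κ.open_source.mem_nhds hκx₀] with x hx
  rw [SymplecticForm.pullback, κ.left_inv hx]
  rfl

variable [FiniteDimensional ℝ E] {g η : X → E →L[ℝ] E →L[ℝ] ℝ} {J : X → E →L[ℝ] E}

theorem contMDiffAt_inCoordinates_polar [IsManifold 𝓘(ℝ, E) 1 X] {x₀ : X}
    (hg : ∀ x, IsInnerForm (g x)) (hη : ∀ x u v, η x u v = -η x v u)
    (hJ : ∀ x, IsPolar (g x) (η x) (J x)) (hgsmooth : IsSmoothFormAt g x₀)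
    (hηsmooth : IsSmoothFormAt η x₀) :
    ContMDiffAt 𝓘(ℝ, E) 𝓘(ℝ, E →L[ℝ] E) ∞ (fun x ↦ ContinuousLinearMap.inCoordinates E
      (TangentSpace 𝓘(ℝ, E)) E (TangentSpace 𝓘(ℝ, E)) x₀ x x₀ x (J x)) x₀ := by
  let κ := chartAt E x₀
  have hκ : IsPartialDiffeo E E κ := isPartialDiffeo_chartAt x₀
  have hκx₀ : x₀ ∈ κ.source := mem_chart_source E x₀
  have hinner : ∀ x ∈ κ.source, IsInnerForm (formInChart g x₀ x) := fun x hx ↦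
    (hg x).bilinearComp (hκ.symm.differential_injective (κ.map_source hx))
  have hskew : ∀ x u v, formInChart η x₀ x u v = -formInChart η x₀ x v u := fun x _ _ ↦ hη x _ _
  have hpolar : ∀ x ∈ κ.source, IsPolar (formInChart g x₀ x) (formInChart η x₀ x)
      (differential E E κ x ∘L J x ∘L differential E E κ.symm (κ x)) := fun x hx ↦
    (hJ x).bilinearComp (hκ.differential_differential_symm hx)
      (hκ.differential_symm_differential hx)
  obtain ⟨Ψ, hΨ, hΨpolar⟩ := exists_smooth_polar (hinner x₀ hκx₀) (hskew x₀) fun u hu ↦ by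
    by_contra hne
    exact ((hpolar x₀ hκx₀).pos u hne).ne' (hu _)
  have hpair := hgsmooth.prodMk_space hηsmooth
  refine (hΨ.contMDiffAt.comp (g := Ψ) x₀ hpair).congr_of_eventuallyEq ?_
  filter_upwards [hpair.continuousAt.eventually hΨpolar, κ.open_source.mem_nhds hκx₀]
    with x hx hxκ
  exact (inCoordinates_tangentSpace hxκ (J x)).trans
    ((hpolar x hxκ).unique (hinner x hxκ) (hskew x) (hx (hinner x hxκ) (hskew x)))

theorem exists_almostComplexStructure_isPolar (σ : SymplecticForm E X)
    (hg : ∀ x, IsInnerForm (g x)) (hsmooth : ∀ x, IsSmoothFormAt g x) :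
    ∃ J : AlmostComplexStructure E X, ∀ x, IsPolar (g x) (σ.bilin x) (J.toEnd x) := by
  have : IsManifold 𝓘(ℝ, E) 1 X := .of_le (n := ∞) (by simp)
  have hpolar : ∀ x, ∃ J, IsPolar (g x) (σ.bilin x) J := fun x ↦ by
    obtain ⟨Ψ, -, hΨ⟩ := exists_smooth_polar (hg x) (σ.bilin_skew x)
      fun _ ↦ σ.eq_zero_of_bilin_eq_zero x
    exact ⟨_, hΨ.self_of_nhds (hg x) (σ.bilin_skew x)⟩
  choose J hJ using hpolar
  exact ⟨⟨J, fun x₀ ↦ (contMDiffAt_hom_bundle _).2 ⟨contMDiffAt_id,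
    contMDiffAt_inCoordinates_polar hg σ.bilin_skew hJ (hsmooth x₀) (σ.isSmoothFormAt x₀)⟩,
    fun x ↦ (hJ x).sq⟩, hJ⟩

end FormFields

/-! ### Gluing metrics -/

section Gluing

variable {V : Type*} [NormedAddCommGroup V] [NormedSpace ℝ V]

theorem isInnerForm_sum_smul {κ : Type*} {s : Finset κ} {r : κ → ℝ} {b : κ → V →L[ℝ] V →L[ℝ] ℝ}
    (hr : ∀ i ∈ s, 0 < r i) (hs : s.Nonempty) (hb : ∀ i ∈ s, IsInnerForm (b i)) :
    IsInnerForm (∑ i ∈ s, r i • b i) where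
  symm u v := by
    simp only [_root_.sum_apply, _root_.smul_apply]
    exact Finset.sum_congr rfl fun i hi ↦ by rw [(hb i hi).symm]
  pos u hu := by
    simp only [_root_.sum_apply, _root_.smul_apply, smul_eq_mul]
    exact Finset.sum_pos (fun i hi ↦ mul_pos (hr i hi) ((hb i hi).pos u hu)) hs

variable {E : Type*} [NormedAddCommGroup E] [NormedSpace ℝ E]
  {X : Type*} [TopologicalSpace X] [ChartedSpace E X]
  {κ : Type*} (ρ : SmoothPartitionOfUnity κ 𝓘(ℝ, E) X)

/-- The sum of a family of fields of bilinear forms weighted by a partition of unity. -/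
def gluedForm (b : κ → X → E →L[ℝ] E →L[ℝ] ℝ) (x : X) : E →L[ℝ] E →L[ℝ] ℝ :=
  ∑ᶠ i, ρ i x • b i x

variable {b : κ → X → E →L[ℝ] E →L[ℝ] ℝ}

theorem gluedForm_eq_sum (x : X) :
    gluedForm ρ b x = ∑ i ∈ ρ.finsupport x, ρ i x • b i x :=
  (ρ.sum_finsupport_smul_eq_finsum x b).symm

theorem isInnerForm_gluedForm {x : X} (hb : ∀ i, ρ i x ≠ 0 → IsInnerForm (b i x)) :
    IsInnerForm (gluedForm ρ b x) := by
  rw [gluedForm_eq_sum]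
  obtain ⟨i, hi⟩ := ρ.exists_pos_of_mem (mem_univ x)
  refine isInnerForm_sum_smul (fun j hj ↦ ?_) ⟨i, (ρ.mem_finsupport x).2 hi.ne'⟩
    fun j hj ↦ hb j ((ρ.mem_finsupport x).1 hj)
  exact (ρ.nonneg j x).lt_of_ne' ((ρ.mem_finsupport x).1 hj)

theorem formInChart_gluedForm (x₀ x : X) :
    formInChart (gluedForm ρ b) x₀ x = ∑ᶠ i, ρ i x • formInChart (b i) x₀ x := by
  rw [← ρ.sum_finsupport_smul_eq_finsum x fun i ↦ formInChart (b i) x₀, formInChart,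
    gluedForm_eq_sum]
  ext u v
  simp [formInChart]

theorem isSmoothFormAt_gluedForm {x : X} (hb : ∀ i, x ∈ tsupport (ρ i) → IsSmoothFormAt (b i) x) :
    IsSmoothFormAt (gluedForm ρ b) x := by
  unfold IsSmoothFormAt
  rw [funext (formInChart_gluedForm ρ x)]
  exact ρ.contMDiffAt_finsum hb

theorem gluedForm_eventuallyEq {i : κ} {x : X} (hx : ∀ j, j ≠ i → x ∉ tsupport (ρ j)) :
    gluedForm ρ b =ᶠ[𝓝 x] b i := by
  have hclosed : IsClosed (⋃ j : {j // j ≠ i}, tsupport (ρ j)) :=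
    (ρ.locallyFinite.closure.comp_injective Subtype.val_injective).isClosed_iUnion
      fun _ ↦ isClosed_closure
  have hxmem : x ∉ ⋃ j : {j // j ≠ i}, tsupport (ρ j) := by simpa using hx
  filter_upwards [hclosed.isOpen_compl.mem_nhds hxmem] with y hy
  have hzero : ∀ j, j ≠ i → ρ j y = 0 := fun j hj ↦ by
    by_contra hne
    exact hy (mem_iUnion.2 ⟨⟨j, hj⟩, subset_tsupport _ hne⟩)
  have hone : ρ i y = 1 := by rw [← ρ.sum_eq_one (mem_univ y), finsum_eq_single _ i hzero]
  rw [gluedForm, finsum_eq_single _ i fun j hj ↦ by rw [hzero j hj, zero_smul], hone, one_smul]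

variable [FiniteDimensional ℝ E] [IsManifold 𝓘(ℝ, E) ∞ X] [T2Space X] [SigmaCompactSpace X]

theorem exists_glued_innerForm {U : κ → Set X} (hU : ∀ i, IsOpen (U i)) (hcover : ⋃ i, U i = univ)
    (hb : ∀ i, ∀ x ∈ U i, IsInnerForm (b i x))
    (hsmooth : ∀ i, ∀ x ∈ U i, IsSmoothFormAt (b i) x) :
    ∃ g : X → E →L[ℝ] E →L[ℝ] ℝ, (∀ x, IsInnerForm (g x)) ∧ (∀ x, IsSmoothFormAt g x) ∧
      ∀ i x, (∀ j, j ≠ i → x ∉ U j) → g =ᶠ[𝓝 x] b i := by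
  obtain ⟨ρ, hρ⟩ := SmoothPartitionOfUnity.exists_isSubordinate 𝓘(ℝ, E) isClosed_univ U hU
    hcover.superset
  exact ⟨gluedForm ρ b,
    fun x ↦ isInnerForm_gluedForm ρ fun i hi ↦ hb i x (hρ i (subset_tsupport _ hi)),
    fun x ↦ isSmoothFormAt_gluedForm ρ fun i hi ↦ hsmooth i x (hρ i hi),
    fun i x hx ↦ gluedForm_eventuallyEq ρ fun j hj hxj ↦ hx j hj (hρ j hxj)⟩

variable (E X) in
theorem exists_smooth_innerForm :
    ∃ g : X → E →L[ℝ] E →L[ℝ] ℝ, (∀ x, IsInnerForm (g x)) ∧ ∀ x, IsSmoothFormAt g x := by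
  let Λ : E ≃L[ℝ] EuclideanSpace ℝ (Fin (Module.finrank ℝ E)) := toEuclidean
  have hinner := (isInnerForm_innerSL (EuclideanSpace ℝ (Fin (Module.finrank ℝ E)))).bilinearComp
    (T := (Λ : E →L[ℝ] _)) Λ.injective
  obtain ⟨g, hg, hsmooth, -⟩ := exists_glued_innerForm (fun x : X ↦ (chartAt E x).open_source)
    (iUnion_eq_univ_iff.2 fun x ↦ ⟨x, mem_chart_source E x⟩)
    (fun x y hy ↦ hinner.bilinearComp ((isPartialDiffeo_chartAt x).differential_injective hy))
    (fun x y hy ↦ isSmoothFormAt_comp_differential (chartAt E x).open_source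
      (isPartialDiffeo_chartAt x).smooth hy _)
  exact ⟨g, hg, hsmooth⟩

end Gluing

/-! ### Kähler charts -/

section StandardKahlerStructure

variable {n : ℕ}

/-- The Euclidean metric of `ℂⁿ`. -/
def stdMetricForm (n : ℕ) : CSpace n →L[ℝ] CSpace n →L[ℝ] ℝ :=
  ∑ j, ((reCoord j).smulRight (reCoord j) + (imCoord j).smulRight (imCoord j))

theorem stdMetricForm_apply (u v : CSpace n) :
    stdMetricForm n u v = ∑ j, ((u j).re * (v j).re + (u j).im * (v j).im) := by
  simp [stdMetricForm]

theorem isInnerForm_stdMetricForm : IsInnerForm (stdMetricForm n) where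
  symm u v := by
    simp only [stdMetricForm_apply]
    exact Finset.sum_congr rfl fun j _ ↦ by ring
  pos u hu := by
    obtain ⟨j, hj⟩ : ∃ j, u j ≠ 0 := by
      by_contra! h
      exact hu (PiLp.ext h)
    rw [stdMetricForm_apply]
    exact Finset.sum_pos' (fun i _ ↦ Complex.normSq_nonneg (u i))
      ⟨j, Finset.mem_univ j, Complex.normSq_pos.2 hj⟩

/-- Multiplication by `√-1` on `ℂⁿ`. -/
def mulI (n : ℕ) : CSpace n →L[ℝ] CSpace n :=
  (Complex.I • ContinuousLinearMap.id ℂ (CSpace n)).restrictScalars ℝ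

theorem mulI_apply (u : CSpace n) : mulI n u = Complex.I • u := rfl

theorem isPolar_mulI : IsPolar (stdMetricForm n) (stdSymplecticForm n) (mulI n) where
  sq u := by simp [mulI_apply, smul_smul]
  metric u v := by
    simp only [stdMetricForm_apply, mulI_apply]
    exact Finset.sum_congr rfl fun j _ ↦ by simp; ring
  symplectic u v := by
    simp only [stdSymplecticForm_apply, stdSymplectic, mulI_apply]
    exact Finset.sum_congr rfl fun j _ ↦ by simp; ring
  pos u hu := by
    refine (isInnerForm_stdMetricForm.pos u hu).trans_eq ?_
    simp only [stdMetricForm_apply, stdSymplecticForm_apply, stdSymplectic, mulI_apply]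
    exact Finset.sum_congr rfl fun j _ ↦ by simp

theorem mixedPlane_zero : mixedPlane n 0 = realPlane n := by
  ext z
  simp [mixedPlane, realPlane]

theorem eq_zero_of_mem_imagPlane_of_mem_realPlane {z : CSpace n} (h : z ∈ imagPlane n)
    (h' : z ∈ realPlane n) : z = 0 :=
  PiLp.ext fun j ↦ Complex.ext (h j) (h' j)

end StandardKahlerStructure

section KahlerCharts

variable {n : ℕ} {E : Type*} [NormedAddCommGroup E] [NormedSpace ℝ E]
  {X : Type*} [TopologicalSpace X] [ChartedSpace E X] {σ : SymplecticForm E X}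
  {A B : Set X} {x : X} {φ : OpenPartialHomeomorph (CSpace n) X}

/-- The pushforward to `X` of the Euclidean metric of `ℂⁿ` by the parametrization `φ`, meaningful
on `φ.target`. -/
def pushforwardMetric (E : Type*) [NormedAddCommGroup E] [NormedSpace ℝ E] [ChartedSpace E X]
    (φ : OpenPartialHomeomorph (CSpace n) X) (y : X) : E →L[ℝ] E →L[ℝ] ℝ :=
  (stdMetricForm n).bilinearComp (differential E (CSpace n) φ.symm y)
    (differential E (CSpace n) φ.symm y)

namespace IsAdaptedDarbouxChartAt

theorem eq_of_mem (hφ : IsAdaptedDarbouxChartAt σ A B x φ) {y : X} (hy : y ∈ φ.target)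
    (hyAB : y ∈ A ∩ B) : y = x := by
  have hz := φ.map_target hy
  rw [← φ.right_inv hy] at hyAB
  rw [← φ.right_inv hy, eq_zero_of_mem_imagPlane_of_mem_realPlane ((hφ.imag _ hz).1 hyAB.1)
    ((hφ.real _ hz).1 hyAB.2), hφ.map_zero]

theorem mem_target (hφ : IsAdaptedDarbouxChartAt σ A B x φ) : x ∈ φ.target :=
  hφ.map_zero ▸ φ.map_source hφ.zero_mem

theorem source_inter_preimage_left (hφ : IsAdaptedDarbouxChartAt σ A B x φ) :
    φ.source ∩ φ ⁻¹' A = φ.source ∩ imagPlane n :=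
  Set.ext fun z ↦ and_congr_right (hφ.imag z)

theorem source_inter_preimage_right (hφ : IsAdaptedDarbouxChartAt σ A B x φ) :
    φ.source ∩ φ ⁻¹' B = φ.source ∩ realPlane n :=
  Set.ext fun z ↦ and_congr_right (hφ.real z)

theorem restrOpen (hφ : IsAdaptedDarbouxChartAt σ A B x φ) {s : Set (CSpace n)} (hs : IsOpen s)
    (h0 : 0 ∈ s) : IsAdaptedDarbouxChartAt σ A B x (φ.restrOpen s hs) where
  smooth := hφ.smooth.mono inter_subset_left
  smooth_symm := hφ.smooth_symm.mono inter_subset_left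
  zero_mem := ⟨hφ.zero_mem, h0⟩
  map_zero := hφ.map_zero
  pullback z hz := hφ.pullback z hz.1
  imag z hz := hφ.imag z hz.1
  real z hz := hφ.real z hz.1

theorem exists_target_subset (hφ : IsAdaptedDarbouxChartAt σ A B x φ) {W : Set X}
    (hW : W ∈ 𝓝 x) : ∃ φ' : OpenPartialHomeomorph (CSpace n) X,
      IsAdaptedDarbouxChartAt σ A B x φ' ∧ φ'.target ⊆ W ∧
      pushforwardMetric E φ' = pushforwardMetric E φ := by
  let s := φ.source ∩ φ ⁻¹' interior W
  have hs : IsOpen s := φ.isOpen_inter_preimage isOpen_interior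
  have h0 : φ 0 ∈ interior W := by rwa [hφ.map_zero, mem_interior_iff_mem_nhds]
  refine ⟨φ.restrOpen s hs, hφ.restrOpen hs ⟨hφ.zero_mem, h0⟩, fun y hy ↦ ?_, rfl⟩
  rw [← φ.right_inv hy.1]
  exact interior_subset hy.2.2

theorem bilin_eq (hφ : IsAdaptedDarbouxChartAt σ A B x φ) {z : CSpace n} (hz : z ∈ φ.source) :
    σ.bilin (φ z) = (stdSymplecticForm n).bilinearComp
      (differential E (CSpace n) φ.symm (φ z)) (differential E (CSpace n) φ.symm (φ z)) := by
  ext u v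
  rw [← hφ.pullback z hz, ContinuousLinearMap.bilinearComp_apply, σ.pullback_apply,
    hφ.differential_differential_symm hz, hφ.differential_differential_symm hz]

variable [FiniteDimensional ℝ E] [IsManifold 𝓘(ℝ, E) ∞ X]

theorem isKahlerChartAt (hφ : IsAdaptedDarbouxChartAt σ A B x φ) {J : AlmostComplexStructure E X}
    (hJ : ∀ y ∈ φ.target, IsPolar (pushforwardMetric E φ y) (σ.bilin y) (J.toEnd y)) :
    IsKahlerChartAt σ J x φ where
  zero_mem := hφ.zero_mem
  map_zero := hφ.map_zero
  smooth := hφ.smooth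
  smooth_symm := hφ.smooth_symm
  pullback_complex z hz u := by
    have hz' := φ.map_source hz
    have hpush : IsPolar (pushforwardMetric E φ (φ z)) (σ.bilin (φ z))
        (differential (CSpace n) E φ z ∘L mulI n ∘L differential E (CSpace n) φ.symm (φ z)) := by
      rw [hφ.bilin_eq hz]
      exact isPolar_mulI.bilinearComp (hφ.differential_differential_symm hz)
        (hφ.differential_symm_differential hz)
    have hJz := (hJ (φ z) hz').unique
      (isInnerForm_stdMetricForm.bilinearComp (hφ.symm.differential_injective hz'))
      (σ.bilin_skew (φ z)) hpush
    change _ = J.toEnd (φ z) (differential (CSpace n) E φ z u)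
    refine .trans ?_ (DFunLike.congr_fun hJz _).symm
    exact congrArg (fun w ↦ differential (CSpace n) E φ z (mulI n w))
      (hφ.differential_symm_differential hz u).symm
  pullback_symplectic z hz u v := by
    rw [← stdSymplecticForm_apply, ← hφ.pullback z hz, σ.pullback_apply, σ.bilin_apply]
    rfl

end IsAdaptedDarbouxChartAt

variable [IsManifold 𝓘(ℝ, E) ∞ X]

theorem isCompatible_of_isPolar {J : AlmostComplexStructure E X} {g : X → E →L[ℝ] E →L[ℝ] ℝ}
    (hJ : ∀ y, IsPolar (g y) (σ.bilin y) (J.toEnd y)) : J.IsCompatible σ := fun y ↦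
  ⟨fun u v ↦ (σ.bilin_apply y _ _).symm.trans
    (((hJ y).symplectic u v).trans (σ.bilin_apply y u v)),
    fun u hu ↦ ((hJ y).pos u hu).trans_eq (σ.bilin_apply y u _)⟩

variable [FiniteDimensional ℝ E] [T2Space X] [SigmaCompactSpace X]

theorem exists_innerForm_eventuallyEq_pushforwardMetric (hAB : IsClosed (A ∩ B))
    {φ : (A ∩ B : Set X) → OpenPartialHomeomorph (CSpace n) X}
    (hφ : ∀ x : (A ∩ B : Set X), IsAdaptedDarbouxChartAt σ A B x (φ x)) :
    ∃ g : X → E →L[ℝ] E →L[ℝ] ℝ, (∀ x, IsInnerForm (g x)) ∧ (∀ x, IsSmoothFormAt g x) ∧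
      ∀ x : (A ∩ B : Set X), g =ᶠ[𝓝 (x : X)] pushforwardMetric E (φ x) := by
  obtain ⟨g₀, hg₀, hg₀smooth⟩ := exists_smooth_innerForm E X
  let b : Option (A ∩ B : Set X) → X → E →L[ℝ] E →L[ℝ] ℝ := fun i ↦
    i.elim g₀ fun x ↦ pushforwardMetric E (φ x)
  let U : Option (A ∩ B : Set X) → Set X := fun i ↦ i.elim (A ∩ B)ᶜ fun x ↦ (φ x).target
  obtain ⟨g, hg, hsmooth, hlocal⟩ := exists_glued_innerForm (b := b) (U := U)
    (Option.rec hAB.isOpen_compl fun x ↦ (φ x).open_target)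
    (iUnion_eq_univ_iff.2 fun y ↦ (em (y ∈ A ∩ B)).elim
      (fun hy ↦ ⟨some ⟨y, hy⟩, (hφ ⟨y, hy⟩).mem_target⟩) fun hy ↦ ⟨none, hy⟩)
    (Option.rec (fun y _ ↦ hg₀ y) fun x y hy ↦
      isInnerForm_stdMetricForm.bilinearComp ((hφ x).symm.differential_injective hy))
    (Option.rec (fun y _ ↦ hg₀smooth y) fun x y hy ↦
      isSmoothFormAt_comp_differential (φ x).open_target (hφ x).smooth_symm hy _)
  refine ⟨g, hg, hsmooth, fun x ↦ hlocal (some x) x ?_⟩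
  rintro (_ | y) hyx hxy
  · exact hxy x.2
  · exact hyx (congrArg some (Subtype.ext ((hφ y).eq_of_mem hxy x.2)).symm)

theorem exists_compatible_isKahlerChartAt (hAB : IsClosed (A ∩ B))
    (hchart : ∀ x ∈ A ∩ B, ∃ φ : OpenPartialHomeomorph (CSpace n) X,
      IsAdaptedDarbouxChartAt σ A B x φ) :
    ∃ J : AlmostComplexStructure E X, J.IsCompatible σ ∧
      ∀ x ∈ A ∩ B, ∃ φ : OpenPartialHomeomorph (CSpace n) X,
        IsAdaptedDarbouxChartAt σ A B x φ ∧ IsKahlerChartAt σ J x φ := by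
  choose φ hφ using fun x : (A ∩ B : Set X) ↦ hchart x x.2
  obtain ⟨g, hg, hsmooth, hgφ⟩ := exists_innerForm_eventuallyEq_pushforwardMetric hAB hφ
  obtain ⟨J, hJ⟩ := exists_almostComplexStructure_isPolar σ hg hsmooth
  refine ⟨J, isCompatible_of_isPolar hJ, fun x hx ↦ ?_⟩
  obtain ⟨φ', hφ', hW, hmetric⟩ := (hφ ⟨x, hx⟩).exists_target_subset (hgφ ⟨x, hx⟩)
  refine ⟨φ', hφ', hφ'.isKahlerChartAt fun y hy ↦ ?_⟩
  rw [hmetric, ← hW hy]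
  exact hJ y

end KahlerCharts

theorem mainTheorem6_general (n : ℕ)
    {E : Type*} [NormedAddCommGroup E] [NormedSpace ℝ E] [FiniteDimensional ℝ E]
    {X : Type*} [TopologicalSpace X] [T2Space X] [SigmaCompactSpace X]
    [ChartedSpace E X] [IsManifold 𝓘(ℝ, E) ∞ X] (σ : SymplecticForm E X)
    {L L' : Type*}
    [TopologicalSpace L] [ChartedSpace (EuclideanSpace ℝ (Fin n)) L]
    [TopologicalSpace L'] [ChartedSpace (EuclideanSpace ℝ (Fin n)) L']
    (ι : L → X) (ι' : L' → X)
    (hι : IsLagrangianEmbedding n σ ι) (hι' : IsLagrangianEmbedding n σ ι')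
    (htrans : IntersectTransversely n E ι ι') (hclosed : IsClosed (range ι ∩ range ι')) :
    ∃ J : AlmostComplexStructure E X,
      J.IsCompatible σ ∧
      LocallyStandard n σ J (range ι) (range ι') ∧
      ∀ x ∈ range ι ∩ range ι', ∃ φ : OpenPartialHomeomorph (CSpace n) X,
        IsKahlerChartAt σ J x φ ∧
        φ.source ∩ φ ⁻¹' range ι = φ.source ∩ imagPlane n ∧
        φ.source ∩ φ ⁻¹' range ι' = φ.source ∩ realPlane n := by
  obtain ⟨J, hJσ, hJ⟩ := exists_compatible_isKahlerChartAt (n := n) (σ := σ) hclosed <| by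
    rintro _ ⟨⟨p, rfl⟩, q, hq⟩
    exact exists_isAdaptedDarbouxChartAt hι hι' hq.symm (htrans p q hq.symm)
  refine ⟨J, hJσ, fun x hx ↦ ?_, fun x hx ↦ ?_⟩ <;> obtain ⟨φ, hφ, hφJ⟩ := hJ x hx
  · exact ⟨φ, 0, n.zero_le, hφJ, hφ.source_inter_preimage_left,
      mixedPlane_zero ▸ hφ.source_inter_preimage_right⟩
  · exact ⟨φ, hφJ, hφ.source_inter_preimage_left, hφ.source_inter_preimage_right⟩

end

theorem mainTheorem6 (n : ℕ)
    {X : Type*} [TopologicalSpace X] [T2Space X] [SecondCountableTopology X]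
    [ChartedSpace (EuclideanSpace ℝ (Fin (2 * n))) X]
    [IsManifold (𝓡 (2 * n)) ∞ X]
    (σ : SymplecticForm (EuclideanSpace ℝ (Fin (2 * n))) X)
    {L L' : Type*}
    [TopologicalSpace L] [ChartedSpace (EuclideanSpace ℝ (Fin n)) L] [IsManifold (𝓡 n) ∞ L]
    [TopologicalSpace L'] [ChartedSpace (EuclideanSpace ℝ (Fin n)) L'] [IsManifold (𝓡 n) ∞ L']
    (ι : L → X) (ι' : L' → X)
    (hι : IsLagrangianEmbedding n σ ι) (hι' : IsLagrangianEmbedding n σ ι')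
    (htrans : IntersectTransversely n (EuclideanSpace ℝ (Fin (2 * n))) ι ι')
    (hclosed : IsClosed (Set.range ι ∩ Set.range ι')) :
    ∃ J : AlmostComplexStructure (EuclideanSpace ℝ (Fin (2 * n))) X,
      J.IsCompatible σ ∧
      LocallyStandard n σ J (Set.range ι) (Set.range ι') ∧
      ∀ x ∈ Set.range ι ∩ Set.range ι', ∃ φ : OpenPartialHomeomorph (CSpace n) X,
        IsKahlerChartAt σ J x φ ∧
        φ.source ∩ φ ⁻¹' Set.range ι = φ.source ∩ imagPlane n ∧
        φ.source ∩ φ ⁻¹' Set.range ι' = φ.source ∩ realPlane n := by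
  have : LocallyCompactSpace X :=
    ChartedSpace.locallyCompactSpace (EuclideanSpace ℝ (Fin (2 * n))) X
  exact mainTheorem6_general n σ ι ι' hι hι' htrans hclosed
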